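/- Let $\mathbb R^n$ carry a scalar product, let $A\in\mathrm{Hom}(\mathbb R^n)$, and let $B:[0,\infty)\to\mathrm{Hom}(\mathbb R^n)$ be continuous and bounded. Assume that the characteristic polynomial of $A$ has no (complex) root with real part $1$, and that the system $$y'=\Big(\frac Ax+B(x)\Big)y,\qquad x>0, \tag{1}$$ is exponentially dichotomic on $[a,\infty)$ for some $a>0$. Fix $x_0>0$ and let $Y(x;x_0)$, $x>0$, be the evolution operator of (1) with $Y(x_0;x_0)=E$ (the identity); write $Y^{-1}(s;x_0)=(Y(s;x_0))^{-1}$. Define subspaces of initial values at $x_0$ as follows. $\mathbb V_+$ is the set of $y_0$ with $Y(x;x_0)y_0=O(x^{1+\alpha})$ as $x\to+0$ for some $\alpha>0$; $\mathbb U_-$ is the set of $y_0$ with $Y(x;x_0)y_0=O(e^{-\gamma x})$ as $x\to+\infty$ for some $\gamma>0$; $\mathbb V_-^0$ is a subspace with $\mathbb V_+\cap\mathbb V_-^0=\{0\}$ such that $\mathbb V_+\oplus\mathbb V_-^0$ is the space of those $y_0$ for which $Y(x;x_0)y_0$ extends to a $C^1$ function on $[0,\infty)$. Let $\mathbb L_1=\mathbb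 U_-\cap\mathbb V_+$ and let $\mathbb L_2,\dots,\mathbb L_6$ be any subspaces with $$\mathbb L_1\oplus\mathbb L_2=\mathbb U_-\cap(\mathbb V_+\oplus\mathbb V_-^0),\quad \big(\mathbb U_-\cap(\mathbb V_+\oplus\mathbb V_-^0)\big)\oplus\mathbb L_3=\mathbb U_-,\quad \mathbb L_1\oplus\mathbb L_4=\mathbb V_+,$$ $$\Big(\big(\mathbb U_-\cap(\mathbb V_+\oplus\mathbb V_-^0)\big)\oplus\mathbb L_4\Big)\oplus\mathbb L_5=\mathbb V_+\oplus\mathbb V_-^0,\quad \mathbb L_5\subset\mathbb V_-^0,\qquad (\mathbb U_-\oplus\mathbb L_4\oplus\mathbb L_5)\oplus\mathbb L_6=\mathbb R^n .$$ Then $\mathbb R^n=\mathbb L_1\oplus\dots\oplus\mathbb L_6$; let $P_1,\dots,P_6$ be the corresponding projectors. Put $$D=\{(x,s):0<x<s<x_0\}\cup\{(x,s):x_0\le s\le x\},\quad D_+=\{(x,s):0<s\le x\},\quad D_-=\{(x,s):0<x<s\},$$ $$G_1(x,s)=\begin{cases}Y(x;x_0)P_1Y^{-1}(s;x_0),&(x,s)\in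 D\cap D_+,\\-Y(x;x_0)P_1Y^{-1}(s;x_0),&(x,s)\in D\cap D_-,\\0,&(x,s)\in(D_+\cup D_-)\setminus D,\end{cases}$$ $$G_2(x,s)=\begin{cases}Y(x;x_0)(P_2+P_3)Y^{-1}(s;x_0),&(x,s)\in D_+,\\-Y(x;x_0)(P_4+P_5+P_6)Y^{-1}(s;x_0),&(x,s)\in D_-,\end{cases}$$ and $G=G_1+G_2$. Let $g:[0,\infty)\to\mathbb R^n$ be continuous with $g(x)\to0$ as $x\to+\infty$, and consider the boundary value problem $$y'=\Big(\frac Ax+B(x)\Big)y+g(x)\ \ (x>0),\qquad y\in C^1([0,\infty)\to\mathbb R^n),\quad y(+0)=0,\quad y(+\infty)=0. \tag{2}$$ Then the integrals below converge absolutely (the second one for every $x>0$), and problem (2) has a solution if and only if $$\int_0^\infty (P_5+P_6)Y^{-1}(s;x_0)g(s)\,ds=0. \tag{3}$$ If (3) holds, then the solutions of (2) are exactly the functions $y$ with $y(0)=0$ and $$y(x)=Y(x;x_0)v+\int_0^\infty G(x,s)g(s)\,ds,\qquad x>0,$$ where $v$ ranges over $\mathbb L_1$. -/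

import Mathlib

open Set Filter Topology MeasureTheory Asymptotics

namespace SingularODE

section Evolution

variable {E : Type*} [NormedAddCommGroup E] [NormedSpace ℝ E]

/-- The coefficient `A / x + B(x)` of the linear system. -/
noncomputable def coeff (A : E →L[ℝ] E) (B : ℝ → E →L[ℝ] E) (x : ℝ) : E →L[ℝ] E :=
  x⁻¹ • A + B x

/-- `Y` is the evolution operator on `(0, ∞)` of `y' = (A / x + B(x)) y`, normalized at `x₀`:
`Y' = (A / x + B(x)) Y` for `x > 0`, and `Y(x₀)` is the identity. -/
structure IsEvolutionOperator (A : E →L[ℝ] E) (B : ℝ → E →L[ℝ] E) (x₀ : ℝ)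
    (Y : ℝ → E →L[ℝ] E) : Prop where
  apply_base : Y x₀ = 1
  hasDerivAt : ∀ x, 0 < x → HasDerivAt Y (coeff A B x * Y x) x

/-- The evolution operator `Y(x; x₀)`, i.e. the solution of `Y' = (A / x + B(x)) Y` on `(0, ∞)`
with `Y(x₀; x₀)` the identity. It exists by `evolution_spec` below (its values on `(0, ∞)` are
determined by linearity of the equation, those at `x ≤ 0` carry no meaning and are never used). -/
noncomputable def evolution (A : E →L[ℝ] E) (B : ℝ → E →L[ℝ] E) (x₀ : ℝ) : ℝ → E →L[ℝ] E :=
  Classical.epsilon (IsEvolutionOperator A B x₀)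

/-- The inverse `Y⁻¹(s; x₀)` of the evolution operator. -/
noncomputable def evolutionInv (A : E →L[ℝ] E) (B : ℝ → E →L[ℝ] E) (x₀ s : ℝ) : E →L[ℝ] E :=
  Ring.inverse (evolution A B x₀ s)

/-- The iterated integrals of the Peano-Baker series; only used to construct a solution. -/
noncomputable def peanoBaker (M : ℝ → E →L[ℝ] E) (x₀ : ℝ) : ℕ → ℝ → E →L[ℝ] E
  | 0 => fun _ => 1
  | k + 1 => fun x => ∫ s in x₀..x, M s * peanoBaker M x₀ k s

variable [CompleteSpace E]

theorem peanoBaker_continuousOn (M : ℝ → E →L[ℝ] E) {x₀ : ℝ} (hx₀ : 0 < x₀)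
    (hM : ContinuousOn M (Ioi 0)) (k : ℕ) :
    ContinuousOn (peanoBaker M x₀ k) (Ioi 0) ∧
    ∀ x, 0 < x → HasDerivAt (peanoBaker M x₀ (k + 1)) (M x * peanoBaker M x₀ k x) x := by
  have key : ∀ F : ℝ → E →L[ℝ] E, ContinuousOn F (Ioi 0) →
      ∀ x, 0 < x → HasDerivAt (fun x => ∫ s in x₀..x, F s) (F x) x := by
    intro F hF x hx
    refine intervalIntegral.integral_hasDerivAt_right ?_ ?_ (hF.continuousAt (Ioi_mem_nhds hx))
    · refine (hF.mono ?_).intervalIntegrable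
      intro t ht
      exact lt_of_lt_of_le (lt_min hx₀ hx) ht.1
    · exact hF.stronglyMeasurableAtFilter isOpen_Ioi x hx
  induction k with
  | zero => exact ⟨continuousOn_const, key _ (hM.mul continuousOn_const)⟩
  | succ k ih =>
    have hc : ContinuousOn (peanoBaker M x₀ (k + 1)) (Ioi 0) :=
      fun x hx => (ih.2 x hx).continuousAt.continuousWithinAt
    exact ⟨hc, key _ (hM.mul hc)⟩

theorem peanoBaker_norm_le (M : ℝ → E →L[ℝ] E) {x₀ a b C : ℝ} (hx₀ : 0 < x₀) (ha : 0 < a)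
    (hax : a ≤ x₀) (hxb : x₀ ≤ b) (hM : ContinuousOn M (Ioi 0))
    (hC : ∀ x ∈ Icc a b, ‖M x‖ ≤ C) (k : ℕ) :
    ∀ x ∈ Icc a b, ‖peanoBaker M x₀ k x‖ ≤ C ^ k * |x - x₀| ^ k / k.factorial := by
  have hC0 : 0 ≤ C := (norm_nonneg _).trans (hC x₀ ⟨hax, hxb⟩)
  induction k with
  | zero =>
    intro x _
    simpa [peanoBaker, ContinuousLinearMap.one_def] using
      ContinuousLinearMap.norm_id_le (𝕜 := ℝ) (E := E)
  | succ k ih =>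
    intro x hx
    have hsub : uIoc x₀ x ⊆ Icc a b := by
      intro t ht
      rcases mem_uIoc.1 ht with h | h
      · exact ⟨hax.trans h.1.le, h.2.trans hx.2⟩
      · exact ⟨hx.1.trans h.1.le, h.2.trans hxb⟩
    have hint : IntegrableOn
        (fun s => C ^ (k + 1) / k.factorial * |s - x₀| ^ k) (uIoc x₀ x) := by
      have : Continuous fun s : ℝ => C ^ (k + 1) / k.factorial * |s - x₀| ^ k := by fun_prop
      exact (this.intervalIntegrable x₀ x).def'
    have h1 : ‖peanoBaker M x₀ (k + 1) x‖ ≤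
        ∫ s in uIoc x₀ x, C ^ (k + 1) / k.factorial * |s - x₀| ^ k := by
      refine (intervalIntegral.norm_integral_le_integral_norm_uIoc).trans ?_
      have hcont : ContinuousOn (fun s => M s * peanoBaker M x₀ k s) (Ioi 0) :=
        hM.mul (peanoBaker_continuousOn M hx₀ hM k).1
      refine setIntegral_mono_on ?_ hint measurableSet_uIoc ?_
      · have : IntervalIntegrable (fun s => M s * peanoBaker M x₀ k s) volume x₀ x :=
          (hcont.mono fun t ht =>
            lt_of_lt_of_le (lt_min hx₀ (ha.trans_le hx.1)) ht.1).intervalIntegrable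
        exact this.def'.norm
      · intro s hs
        refine (norm_mul_le _ _).trans ?_
        have := mul_le_mul (hC s (hsub hs)) (ih s (hsub hs)) (norm_nonneg _) hC0
        refine this.trans (le_of_eq ?_)
        ring
    refine h1.trans (le_of_eq ?_)
    rw [integral_const_mul, integral_pow_abs_sub_uIoc, Nat.factorial_succ]
    have : (k.factorial : ℝ) ≠ 0 := by positivity
    push_cast
    field_simp

theorem hasDerivAt_tsum_peanoBaker (M : ℝ → E →L[ℝ] E) (hM : ContinuousOn M (Ioi 0))
    {x₀ x : ℝ} (hx₀ : 0 < x₀) (hx : 0 < x) :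
    HasDerivAt (fun x => ∑' k, peanoBaker M x₀ k x) (M x * ∑' k, peanoBaker M x₀ k x) x := by
  set a := min x₀ x / 2 with hadef
  set b := max x₀ x + 1 with hbdef
  have hmin : 0 < min x₀ x := lt_min hx₀ hx
  have ha : 0 < a := by positivity
  have hax₀ : a < x₀ := (half_lt_self hmin).trans_le (min_le_left _ _)
  have hax : a < x := (half_lt_self hmin).trans_le (min_le_right _ _)
  have hxb₀ : x₀ < b := by have := le_max_left x₀ x; linarith
  have hxb : x < b := by have := le_max_right x₀ x; linarith
  obtain ⟨C, hC⟩ := (isCompact_Icc (a := a) (b := b)).exists_bound_of_continuousOn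
    (hM.mono fun t ht => ha.trans_le ht.1)
  have hC0 : 0 ≤ C := (norm_nonneg _).trans (hC x₀ ⟨hax₀.le, hxb₀.le⟩)
  have hbd : ∀ k, ∀ y ∈ Ioo a b, ‖peanoBaker M x₀ k y‖ ≤
      (C * (b - a)) ^ k / k.factorial := by
    intro k y hy
    refine (peanoBaker_norm_le M hx₀ ha hax₀.le hxb₀.le hM hC k y ⟨hy.1.le, hy.2.le⟩).trans ?_
    rw [mul_pow]
    have : |y - x₀| ≤ b - a := by
      rw [abs_le]; constructor <;> linarith [hy.1, hy.2]
    gcongr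
  have hsum : Summable fun k : ℕ => (C * (b - a)) ^ k / k.factorial :=
    Real.summable_pow_div_factorial _
  have hsumx : Summable fun k => peanoBaker M x₀ k x :=
    Summable.of_norm_bounded hsum fun k => hbd k x ⟨hax, hxb⟩
  have hder := hasDerivAt_tsum_of_isPreconnected
    (g := fun k y => peanoBaker M x₀ (k + 1) y) (g' := fun k y => M y * peanoBaker M x₀ k y)
    (u := fun k => C * ((C * (b - a)) ^ k / k.factorial)) (t := Ioo a b) (y₀ := x) (y := x)
    (hsum.mul_left C) isOpen_Ioo isPreconnected_Ioo
    (fun k y hy => (peanoBaker_continuousOn M hx₀ hM k).2 y (ha.trans hy.1))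
    (fun k y hy => (norm_mul_le _ _).trans
      (mul_le_mul (hC y ⟨hy.1.le, hy.2.le⟩) (hbd k y hy) (norm_nonneg _) hC0))
    ⟨hax, hxb⟩ ((summable_nat_add_iff 1).2 hsumx) ⟨hax, hxb⟩
  rw [hsumx.tsum_mul_left] at hder
  have hloc : (fun y => ∑' k, peanoBaker M x₀ k y) =ᶠ[𝓝 x]
      fun y => 1 + ∑' k, peanoBaker M x₀ (k + 1) y := by
    filter_upwards [Ioo_mem_nhds hax hxb] with y hy
    exact (Summable.of_norm_bounded hsum fun k => hbd k y hy).tsum_eq_zero_add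
  exact (hder.const_add 1).congr_of_eventuallyEq hloc

/-- The evolution operator exists, whatever the continuous coefficient `B`. -/
theorem exists_evolution (A : E →L[ℝ] E) {B : ℝ → E →L[ℝ] E} (hB : ContinuousOn B (Ici 0))
    {x₀ : ℝ} (hx₀ : 0 < x₀) : ∃ Y, IsEvolutionOperator A B x₀ Y := by
  have hM : ContinuousOn (coeff A B) (Ioi 0) := by
    have hinv : ContinuousOn (fun x : ℝ => x⁻¹) (Ioi 0) :=
      continuousOn_inv₀.mono fun x hx => ne_of_gt hx
    exact (hinv.smul (continuousOn_const (c := A))).add (hB.mono Ioi_subset_Ici_self)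
  refine ⟨fun x => ∑' k, peanoBaker (coeff A B) x₀ k x, ?_,
    fun x hx => hasDerivAt_tsum_peanoBaker _ hM hx₀ hx⟩
  rw [tsum_eq_single 0]
  · rfl
  · intro k hk
    obtain ⟨j, rfl⟩ := Nat.exists_eq_succ_of_ne_zero hk
    simp [peanoBaker]

theorem evolution_spec (A : E →L[ℝ] E) {B : ℝ → E →L[ℝ] E} (hB : ContinuousOn B (Ici 0))
    {x₀ : ℝ} (hx₀ : 0 < x₀) : IsEvolutionOperator A B x₀ (evolution A B x₀) :=
  Classical.epsilon_spec (exists_evolution A hB hx₀)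

end Evolution

section Subspaces

variable {E : Type*} [NormedAddCommGroup E] [NormedSpace ℝ E]

/-- The system `y' = (A / x + B(x)) y` is exponentially dichotomic on `[a, ∞)`: for some projector
`P` the solutions starting in its range decay, and those starting in its kernel grow,
exponentially. -/
def IsExpDichotomic (A : E →L[ℝ] E) (B : ℝ → E →L[ℝ] E) (a : ℝ) : Prop :=
  ∃ P : E →L[ℝ] E, P * P = P ∧ ∃ K γ : ℝ, 0 < K ∧ 0 < γ ∧
    (∀ s x, a ≤ s → s ≤ x →
      ‖evolution A B a x * P * evolutionInv A B a s‖ ≤ K * Real.exp (-γ * (x - s))) ∧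
    (∀ s x, a ≤ x → x ≤ s →
      ‖evolution A B a x * (1 - P) * evolutionInv A B a s‖ ≤ K * Real.exp (-γ * (s - x)))

/-- The subspace `V₊` of those initial values at `x₀` whose solutions of the homogeneous system
are `O(x ^ (1 + α))` as `x → +0`, for some `α > 0`. -/
def spaceVPlus (A : E →L[ℝ] E) (B : ℝ → E →L[ℝ] E) (x₀ : ℝ) : Submodule ℝ E where
  carrier := {y₀ | ∃ α : ℝ, 0 < α ∧
    (fun x => evolution A B x₀ x y₀) =O[𝓝[>] 0] fun x : ℝ => x ^ (1 + α)}
  zero_mem' := ⟨1, one_pos, by simpa using isBigO_zero _ _⟩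
  add_mem' := by
    have mono : ∀ α β : ℝ, α ≤ β →
        (fun x : ℝ => x ^ (1 + β)) =O[𝓝[>] 0] fun x : ℝ => x ^ (1 + α) := by
      intro α β h
      refine IsBigO.of_bound 1 ?_
      filter_upwards [Ioo_mem_nhdsGT (zero_lt_one' ℝ)] with x hx
      rw [Real.norm_of_nonneg (Real.rpow_nonneg hx.1.le _),
        Real.norm_of_nonneg (Real.rpow_nonneg hx.1.le _), one_mul]
      exact Real.rpow_le_rpow_of_exponent_ge hx.1 hx.2.le (by linarith)
    rintro u v ⟨α, hα, hu⟩ ⟨β, hβ, hv⟩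
    refine ⟨min α β, lt_min hα hβ, ?_⟩
    simp only [map_add]
    exact (hu.trans (mono _ _ (min_le_left _ _))).add (hv.trans (mono _ _ (min_le_right _ _)))
  smul_mem' := by
    rintro c u ⟨α, hα, hu⟩
    refine ⟨α, hα, ?_⟩
    simp only [map_smul]
    exact hu.const_smul_left c

/-- The subspace `U₋` of those initial values at `x₀` whose solutions of the homogeneous system
are `O(exp (-γ x))` as `x → +∞`, for some `γ > 0`. -/
def spaceUMinus (A : E →L[ℝ] E) (B : ℝ → E →L[ℝ] E) (x₀ : ℝ) : Submodule ℝ E where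
  carrier := {y₀ | ∃ γ : ℝ, 0 < γ ∧
    (fun x => evolution A B x₀ x y₀) =O[atTop] fun x : ℝ => Real.exp (-γ * x)}
  zero_mem' := ⟨1, one_pos, by simpa using isBigO_zero _ _⟩
  add_mem' := by
    have mono : ∀ α β : ℝ, α ≤ β →
        (fun x : ℝ => Real.exp (-β * x)) =O[atTop] fun x : ℝ => Real.exp (-α * x) := by
      intro α β h
      refine IsBigO.of_bound 1 ?_
      filter_upwards [eventually_ge_atTop 0] with x hx
      rw [Real.norm_of_nonneg (Real.exp_pos _).le, Real.norm_of_nonneg (Real.exp_pos _).le, one_mul]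
      exact Real.exp_le_exp.2 (by nlinarith)
    rintro u v ⟨α, hα, hu⟩ ⟨β, hβ, hv⟩
    refine ⟨min α β, lt_min hα hβ, ?_⟩
    simp only [map_add]
    exact (hu.trans (mono _ _ (min_le_left _ _))).add (hv.trans (mono _ _ (min_le_right _ _)))
  smul_mem' := by
    rintro c u ⟨α, hα, hu⟩
    refine ⟨α, hα, ?_⟩
    simp only [map_smul]
    exact hu.const_smul_left c

/-- The subspace of those initial values at `x₀` whose solutions of the homogeneous system are
continuously differentiable on `[0, ∞)` (after extension to `x = 0`). -/
def spaceCOne (A : E →L[ℝ] E) (B : ℝ → E →L[ℝ] E) (x₀ : ℝ) : Submodule ℝ E where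
  carrier := {y₀ | ∃ z : ℝ → E, ContDiffOn ℝ 1 z (Ici 0) ∧ ∀ x, 0 < x → z x = evolution A B x₀ x y₀}
  zero_mem' := ⟨fun _ => 0, contDiffOn_const, by simp⟩
  add_mem' := by
    rintro u v ⟨z, hz, hzu⟩ ⟨w, hw, hwv⟩
    exact ⟨fun x => z x + w x, hz.add hw, fun x hx => by simp [hzu x hx, hwv x hx]⟩
  smul_mem' := by
    rintro c u ⟨z, hz, hzu⟩
    exact ⟨fun x => c • z x, contDiffOn_const.smul hz, fun x hx => by simp [hzu x hx]⟩

/-- `V0` is a choice of `V₋⁰`, and `L 0, …, L 5` is a choice of the subspaces `L₁, …, L₆`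
(in this order: `L i` is the subspace with number `i + 1`). -/
structure IsSplitting (A : E →L[ℝ] E) (B : ℝ → E →L[ℝ] E) (x₀ : ℝ)
    (V0 : Submodule ℝ E) (L : Fin 6 → Submodule ℝ E) : Prop where
  disjoint_V0 : Disjoint (spaceVPlus A B x₀) V0
  sup_V0 : spaceVPlus A B x₀ ⊔ V0 = spaceCOne A B x₀
  L1_eq : L 0 = spaceUMinus A B x₀ ⊓ spaceVPlus A B x₀
  disjoint_L2 : Disjoint (L 0) (L 1)
  sup_L2 : L 0 ⊔ L 1 = spaceUMinus A B x₀ ⊓ (spaceVPlus A B x₀ ⊔ V0)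
  disjoint_L3 : Disjoint (spaceUMinus A B x₀ ⊓ (spaceVPlus A B x₀ ⊔ V0)) (L 2)
  sup_L3 : (spaceUMinus A B x₀ ⊓ (spaceVPlus A B x₀ ⊔ V0)) ⊔ L 2 = spaceUMinus A B x₀
  disjoint_L4 : Disjoint (L 0) (L 3)
  sup_L4 : L 0 ⊔ L 3 = spaceVPlus A B x₀
  disjoint_L5 : Disjoint ((spaceUMinus A B x₀ ⊓ (spaceVPlus A B x₀ ⊔ V0)) ⊔ L 3) (L 4)
  sup_L5 : ((spaceUMinus A B x₀ ⊓ (spaceVPlus A B x₀ ⊔ V0)) ⊔ L 3) ⊔ L 4 = spaceVPlus A B x₀ ⊔ V0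
  L5_le : L 4 ≤ V0
  isCompl_L6 : IsCompl (spaceUMinus A B x₀ ⊔ L 3 ⊔ L 4) (L 5)

/-- The subspaces `L₁, …, L₆` form a direct sum decomposition of the whole space. -/
theorem IsSplitting.isCompl {A : E →L[ℝ] E} {B : ℝ → E →L[ℝ] E} {x₀ : ℝ}
    {V0 : Submodule ℝ E} {L : Fin 6 → Submodule ℝ E} (h : IsSplitting A B x₀ V0 L) (i : Fin 6) :
    IsCompl (L i) (⨆ j, ⨆ (_ : j ≠ i), L j) := by
  set U := spaceUMinus A B x₀
  set V := spaceVPlus A B x₀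
  have e3 : L 0 ⊔ L 1 ⊔ L 2 = U := by rw [h.sup_L2, h.sup_L3]
  have hL4 : L 3 ≤ V := le_sup_right.trans h.sup_L4.le
  have hL5 : L 4 ≤ V ⊔ V0 := h.L5_le.trans le_sup_right
  have d4 : Disjoint (L 3) U := by
    rw [Submodule.disjoint_def]
    intro x hx hxU
    have hx0 : x ∈ L 0 := by rw [h.L1_eq]; exact ⟨hxU, hL4 hx⟩
    exact Submodule.disjoint_def.1 h.disjoint_L4 x hx0 hx
  have d5 : Disjoint (L 4) (U ⊔ L 3) := by
    rw [Submodule.disjoint_def]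
    intro x hx hxs
    obtain ⟨u, hu, w, hw, rfl⟩ := Submodule.mem_sup.1 hxs
    have huC : u ∈ V ⊔ V0 := by
      have := Submodule.sub_mem _ (hL5 hx) (Submodule.mem_sup_left (T := V0) (hL4 hw))
      simpa using this
    exact Submodule.disjoint_def.1 h.disjoint_L5 _
      (Submodule.add_mem_sup ⟨hu, huC⟩ hw) hx
  have hind : iSupIndep L := by
    rw [iSupIndep_iff_supIndep_univ]
    have hu : (Finset.univ : Finset (Fin 6)) =
        insert 5 (insert 4 (insert 3 (insert 2 (insert 1 {0})))) := by decide
    rw [hu]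
    refine Finset.SupIndep.insert (Finset.SupIndep.insert (Finset.SupIndep.insert
      (Finset.SupIndep.insert (Finset.SupIndep.insert (Finset.supIndep_singleton _ _) ?_) ?_) ?_)
      ?_) ?_
    · simpa using h.disjoint_L2.symm
    · have := h.disjoint_L3.symm
      rw [← h.sup_L2] at this
      simpa [sup_comm, sup_left_comm, sup_assoc] using this
    · rw [← e3] at d4
      simpa [sup_comm, sup_left_comm, sup_assoc] using d4
    · rw [← e3] at d5
      simpa [sup_comm, sup_left_comm, sup_assoc] using d5
    · have : Disjoint (L 5) (U ⊔ L 3 ⊔ L 4) := h.isCompl_L6.disjoint.symm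
      rw [← e3] at this
      simpa [sup_comm, sup_left_comm, sup_assoc] using this
  refine ⟨hind i, ?_⟩
  rw [codisjoint_iff, eq_top_iff]
  have htop : ⨆ j, L j = ⊤ := by
    have ht : U ⊔ L 3 ⊔ L 4 ⊔ L 5 = ⊤ := h.isCompl_L6.sup_eq_top
    rw [eq_top_iff, ← ht, ← e3]
    simp only [sup_le_iff]
    exact ⟨⟨⟨⟨⟨le_iSup L 0, le_iSup L 1⟩, le_iSup L 2⟩, le_iSup L 3⟩, le_iSup L 4⟩, le_iSup L 5⟩
  rw [← htop]
  refine iSup_le fun j => ?_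
  by_cases hj : j = i
  · subst hj; exact le_sup_left
  · exact le_sup_of_le_right (le_iSup₂_of_le j hj le_rfl)

end Subspaces

section Green

variable {E : Type*} [NormedAddCommGroup E] [NormedSpace ℝ E] [FiniteDimensional ℝ E]

open Classical in
/-- The projectors `P₁, …, P₆` of the decomposition `E = L₁ ⊕ ⋯ ⊕ L₆` (again with `proj L i` the
projector with number `i + 1`): `proj L i` is the projector onto `L i` along the sum of the other
subspaces. The second branch does not occur for a splitting, see `IsSplitting.isCompl`. -/
noncomputable def proj (L : Fin 6 → Submodule ℝ E) (i : Fin 6) : E →L[ℝ] E :=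
  if h : IsCompl (L i) (⨆ j, ⨆ (_ : j ≠ i), L j) then
    LinearMap.toContinuousLinearMap ((L i).projection _ h)
  else 0

/-- `D = {(x, s) : 0 < x < s < x₀} ∪ {(x, s) : x₀ ≤ s ≤ x}`. -/
def setD (x₀ : ℝ) : Set (ℝ × ℝ) :=
  {p | 0 < p.1 ∧ p.1 < p.2 ∧ p.2 < x₀} ∪ {p | x₀ ≤ p.2 ∧ p.2 ≤ p.1}

/-- `D₊ = {(x, s) : 0 < s ≤ x}`. -/
def setDPlus : Set (ℝ × ℝ) := {p | 0 < p.2 ∧ p.2 ≤ p.1}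

/-- `D₋ = {(x, s) : 0 < x < s}`. -/
def setDMinus : Set (ℝ × ℝ) := {p | 0 < p.1 ∧ p.1 < p.2}

open Classical in
/-- The kernel `G₁(x, s)`. -/
noncomputable def green1 (A : E →L[ℝ] E) (B : ℝ → E →L[ℝ] E) (x₀ : ℝ)
    (L : Fin 6 → Submodule ℝ E) (x s : ℝ) : E →L[ℝ] E :=
  if (x, s) ∈ setD x₀ ∩ setDPlus then
    evolution A B x₀ x * proj L 0 * evolutionInv A B x₀ s
  else if (x, s) ∈ setD x₀ ∩ setDMinus then
    -(evolution A B x₀ x * proj L 0 * evolutionInv A B x₀ s)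
  else 0

open Classical in
/-- The kernel `G₂(x, s)`. -/
noncomputable def green2 (A : E →L[ℝ] E) (B : ℝ → E →L[ℝ] E) (x₀ : ℝ)
    (L : Fin 6 → Submodule ℝ E) (x s : ℝ) : E →L[ℝ] E :=
  if (x, s) ∈ setDPlus then
    evolution A B x₀ x * (proj L 1 + proj L 2) * evolutionInv A B x₀ s
  else if (x, s) ∈ setDMinus then
    -(evolution A B x₀ x * (proj L 3 + proj L 4 + proj L 5) * evolutionInv A B x₀ s)
  else 0

/-- The kernel `G(x, s) = G₁(x, s) + G₂(x, s)`. -/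
noncomputable def green (A : E →L[ℝ] E) (B : ℝ → E →L[ℝ] E) (x₀ : ℝ)
    (L : Fin 6 → Submodule ℝ E) (x s : ℝ) : E →L[ℝ] E :=
  green1 A B x₀ L x s + green2 A B x₀ L x s

end Green

/-- `y` is a solution of the boundary value problem `y' = (A / x + B(x)) y + g(x)` for `x > 0`,
`y ∈ C¹([0, ∞))`, `y(+0) = 0`, `y(+∞) = 0`. Values at negative arguments play no role. -/
structure IsBVPSolution {E : Type*} [NormedAddCommGroup E] [NormedSpace ℝ E]
    (A : E →L[ℝ] E) (B : ℝ → E →L[ℝ] E) (g : ℝ → E) (y : ℝ → E) : Prop where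
  contDiffOn : ContDiffOn ℝ 1 y (Ici 0)
  hasDerivAt : ∀ x, 0 < x → HasDerivAt y (coeff A B x (y x) + g x) x
  tendsto_zero : Tendsto y (𝓝[>] 0) (𝓝 0)
  tendsto_atTop : Tendsto y atTop (𝓝 0)

end SingularODE

/-! By variation of constants every solution on (0, ∞) is Y(x)(c + ∫_{x₀}^x Y⁻¹g), so the problem is
to find the admissible c. A C¹ solution vanishing at 0 is O(x), and an O(x) solution is C¹ up to 0
(`contDiffOn_of_isBigO`), so there is one condition at each end: O(x) at zero, decay at infinity.

Each end gives a linear equation for c. If Q has kernel U₋, decay means Qc = -∫_{x₀}^∞ QY⁻¹g; this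
is the classical dichotomy argument, U₋ being the range of the dichotomy projector. If Q₀ has kernel
V₊, being O(x) means Q₀c = ∫_0^{x₀} Q₀Y⁻¹g.

The end at zero needs more work. With x = eᵗ and u = y/x the system becomes u' = (A - 1 + eᵗB)u + g,
where A - 1 has no purely imaginary eigenvalue and eᵗB is small near t = -∞. Hence there is an O(x)
solution bounded linearly by sup |g| (`exists_variation_norm_le`). Testing this against right-hand
sides aligned with ℓY⁻¹, for a functional ℓ vanishing on V₊, shows that ℓY⁻¹ is integrable at zero
(`integrableOn_norm_functional`); since 1/x is not, the equation for Q₀c follows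
(`projection_eq_of_isBigO`). The constant-coefficient facts about A - 1 are proved by induction on
the real irreducible factors of an annihilating polynomial, which takes the place of a Jordan form.

What remains is linear algebra. Since V₊ = L₁ ⊕ L₄ and U₋ = L₁ ⊕ L₂ ⊕ L₃, one takes Q₀ = P₂ + P₃ +
P₅ + P₆ and Q = P₄ + P₅ + P₆. They share P₅ + P₆, and the two equations are compatible exactly when
∫_0^∞ (P₅ + P₆)Y⁻¹g = 0. The Green function integral is the solution with c₀ = ∫_0^{x₀} (P₂ +
P₃)Y⁻¹g - ∫_{x₀}^∞ (P₄ + P₅ + P₆)Y⁻¹g, and c is determined up to U₋ ∩ V₊ = L₁. -/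

namespace SingularODE

/-! ### Evolution operator and variation of constants -/

section EvolutionBasics

variable {E : Type*} [NormedAddCommGroup E] [NormedSpace ℝ E]

theorem continuousOn_coeff (A : E →L[ℝ] E) {B : ℝ → E →L[ℝ] E} (hB : ContinuousOn B (Ici 0)) :
    ContinuousOn (coeff A B) (Ioi 0) := by
  have hinv : ContinuousOn (fun x : ℝ => x⁻¹) (Ioi 0) :=
    continuousOn_inv₀.mono fun x hx => ne_of_gt hx
  exact (hinv.smul (continuousOn_const (c := A))).add (hB.mono Ioi_subset_Ici_self)

/-- Two solutions of a linear equation on `(0, ∞)` that agree at one point agree everywhere. -/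
theorem eqOn_Ioi_of_linear {M : ℝ → E →L[ℝ] E} (hM : ContinuousOn M (Ioi 0)) {u w : ℝ → E}
    (hu : ∀ x, 0 < x → HasDerivAt u (M x (u x)) x) (hw : ∀ x, 0 < x → HasDerivAt w (M x (w x)) x)
    {x₁ : ℝ} (hx₁ : 0 < x₁) (h : u x₁ = w x₁) : EqOn u w (Ioi 0) := by
  intro x hx
  have hx : 0 < x := hx
  set a := min x₁ x / 2
  set b := max x₁ x + 1
  have hmin : 0 < min x₁ x := lt_min hx₁ hx
  have ha : 0 < a := by positivity
  have ha' : a < min x₁ x := half_lt_self hmin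
  have hb : max x₁ x < b := lt_add_one _
  obtain ⟨C, hC⟩ := (isCompact_Icc (a := a) (b := b)).exists_bound_of_continuousOn
    (hM.mono fun t ht => ha.trans_le ht.1)
  refine ODE_solution_unique_of_mem_Ioo (v := fun t y => M t y) (s := fun _ => univ)
    (K := C.toNNReal) (a := a) (b := b) (t₀ := x₁) ?_
    ⟨ha'.trans_le (min_le_left _ _), (le_max_left _ _).trans_lt hb⟩
    (fun t ht => ⟨hu t (ha.trans ht.1), mem_univ _⟩)
    (fun t ht => ⟨hw t (ha.trans ht.1), mem_univ _⟩) h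
    ⟨ha'.trans_le (min_le_right _ _), (le_max_right _ _).trans_lt hb⟩
  intro t ht
  refine ((M t).lipschitz.weaken ?_).lipschitzOnWith
  rw [← NNReal.coe_le_coe]
  exact (hC t ⟨ht.1.le, ht.2.le⟩).trans (Real.le_coe_toNNReal C)

variable [FiniteDimensional ℝ E] {A : E →L[ℝ] E} {B : ℝ → E →L[ℝ] E}
  (hB : ContinuousOn B (Ici 0)) {x₀ : ℝ} (hx₀ : 0 < x₀)
include hB hx₀

theorem hasDerivAt_evolution {x : ℝ} (hx : 0 < x) :
    HasDerivAt (evolution A B x₀) (coeff A B x * evolution A B x₀ x) x :=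
  have := FiniteDimensional.complete ℝ E
  (evolution_spec A hB hx₀).hasDerivAt x hx

theorem evolution_base : evolution A B x₀ x₀ = 1 :=
  have := FiniteDimensional.complete ℝ E
  (evolution_spec A hB hx₀).apply_base

theorem hasDerivAt_evolution_apply (v : E) {x : ℝ} (hx : 0 < x) :
    HasDerivAt (fun x => evolution A B x₀ x v) (coeff A B x (evolution A B x₀ x v)) x := by
  simpa using (hasDerivAt_evolution hB hx₀ hx (A := A)).clm_apply (hasDerivAt_const x v)

/-- Solutions that meet at x coincide at x₀ by uniqueness, so Y(x) is injective, hence bijective in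
finite dimension. -/
theorem isUnit_evolution {x : ℝ} (hx : 0 < x) : IsUnit (evolution A B x₀ x) := by
  have := FiniteDimensional.complete ℝ E
  have hinj : Function.Injective (evolution A B x₀ x) := by
    intro u v huv
    have := eqOn_Ioi_of_linear (continuousOn_coeff A hB)
      (fun y hy => hasDerivAt_evolution_apply hB hx₀ (A := A) u hy)
      (fun y hy => hasDerivAt_evolution_apply hB hx₀ v hy) hx huv hx₀
    simpa [evolution_base hB hx₀] using this
  rw [ContinuousLinearMap.isUnit_iff_bijective]
  exact ⟨hinj, LinearMap.surjective_of_injective (f := (evolution A B x₀ x : E →ₗ[ℝ] E)) hinj⟩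

theorem evolution_mul_inv {x : ℝ} (hx : 0 < x) :
    evolution A B x₀ x * evolutionInv A B x₀ x = 1 :=
  Ring.mul_inverse_cancel _ (isUnit_evolution hB hx₀ hx)

theorem evolutionInv_mul {x : ℝ} (hx : 0 < x) :
    evolutionInv A B x₀ x * evolution A B x₀ x = 1 :=
  Ring.inverse_mul_cancel _ (isUnit_evolution hB hx₀ hx)

theorem evolution_inv_apply {x : ℝ} (hx : 0 < x) (v : E) :
    evolution A B x₀ x (evolutionInv A B x₀ x v) = v :=
  DFunLike.congr_fun (evolution_mul_inv hB hx₀ hx (A := A)) v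

theorem evolutionInv_apply {x : ℝ} (hx : 0 < x) (v : E) :
    evolutionInv A B x₀ x (evolution A B x₀ x v) = v :=
  DFunLike.congr_fun (evolutionInv_mul hB hx₀ hx (A := A)) v

theorem hasDerivAt_evolutionInv {x : ℝ} (hx : 0 < x) :
    HasDerivAt (evolutionInv A B x₀) (-(evolutionInv A B x₀ x * coeff A B x)) x := by
  have := FiniteDimensional.complete ℝ E
  obtain ⟨u, hu⟩ := isUnit_evolution hB hx₀ hx (A := A)
  have h := hasFDerivAt_ringInverse (𝕜 := ℝ) u
  rw [hu] at h
  have h2 := h.comp_hasDerivAt x (hasDerivAt_evolution hB hx₀ hx)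
  have h3 : (↑u⁻¹ : E →L[ℝ] E) = evolutionInv A B x₀ x := by
    rw [evolutionInv, ← hu, Ring.inverse_unit]
  refine h2.congr_deriv ?_
  simp only [h3, neg_apply, ContinuousLinearMap.mulLeftRight_apply]
  rw [mul_assoc, mul_assoc, evolution_mul_inv hB hx₀ hx, mul_one]

theorem continuousOn_evolutionInv : ContinuousOn (evolutionInv A B x₀) (Ioi 0) :=
  fun _ hx => (hasDerivAt_evolutionInv hB hx₀ hx).continuousAt.continuousWithinAt

omit hB in
theorem hasDerivAt_integral_Ioi {F : ℝ → E} (hF : ContinuousOn F (Ioi 0)) {x : ℝ} (hx : 0 < x) :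
    HasDerivAt (fun x => ∫ s in x₀..x, F s) (F x) x := by
  have := FiniteDimensional.complete ℝ E
  refine intervalIntegral.integral_hasDerivAt_right ?_ ?_ (hF.continuousAt (Ioi_mem_nhds hx))
  · refine (hF.mono ?_).intervalIntegrable
    intro t ht
    exact lt_of_lt_of_le (lt_min hx₀ hx) ht.1
  · exact hF.stronglyMeasurableAtFilter isOpen_Ioi x hx

omit hB hx₀ [NormedSpace ℝ E] [FiniteDimensional ℝ E] in
theorem intervalIntegrable_Ioi {F : ℝ → E} (hF : ContinuousOn F (Ioi 0)) {x y : ℝ}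
    (hx : 0 < x) (hy : 0 < y) : IntervalIntegrable F volume x y :=
  (hF.mono fun _ ht => lt_of_lt_of_le (lt_min hx hy) ht.1).intervalIntegrable

/-- The function given by the variation of constants formula solves the inhomogeneous system. -/
theorem hasDerivAt_variation {f : ℝ → E} (hf : ContinuousOn f (Ioi 0)) (c : E) {x : ℝ}
    (hx : 0 < x) :
    HasDerivAt (fun x => evolution A B x₀ x (c + ∫ s in x₀..x, evolutionInv A B x₀ s (f s)))
      (coeff A B x (evolution A B x₀ x (c + ∫ s in x₀..x, evolutionInv A B x₀ s (f s))) + f x)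
      x := by
  have h1 := (hasDerivAt_integral_Ioi hx₀
    ((continuousOn_evolutionInv hB hx₀ (A := A)).clm_apply hf) hx).const_add c
  refine ((hasDerivAt_evolution hB hx₀ hx).clm_apply h1).congr_deriv ?_
  simp [evolution_inv_apply hB hx₀ hx]

/-- Every solution of the inhomogeneous system is given by the variation of constants formula. -/
theorem exists_variation {f : ℝ → E} (hf : ContinuousOn f (Ioi 0)) {s : Set ℝ} (hs : IsOpen s)
    (hs' : IsPreconnected s) (hs0 : s ⊆ Ioi 0) {y : ℝ → E}
    (hy : ∀ x ∈ s, HasDerivAt y (coeff A B x (y x) + f x) x) :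
    ∃ c, ∀ x ∈ s,
      y x = evolution A B x₀ x (c + ∫ s in x₀..x, evolutionInv A B x₀ s (f s)) := by
  -- The constant is recovered as Y⁻¹y - ∫Y⁻¹f, whose derivative vanishes.
  have hd : ∀ x ∈ s, HasDerivAt
      (fun x => evolutionInv A B x₀ x (y x) - ∫ s in x₀..x, evolutionInv A B x₀ s (f s)) 0 x := by
    intro x hx
    refine (((hasDerivAt_evolutionInv hB hx₀ (hs0 hx)).clm_apply (hy x hx)).sub
      (hasDerivAt_integral_Ioi hx₀
        ((continuousOn_evolutionInv hB hx₀ (A := A)).clm_apply hf) (hs0 hx))).congr_deriv ?_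
    simp
  obtain ⟨c, hc⟩ := hs.exists_is_const_of_deriv_eq_zero hs'
    (fun x hx => (hd x hx).differentiableAt.differentiableWithinAt) (fun x hx => (hd x hx).deriv)
  refine ⟨c, fun x hx => ?_⟩
  rw [← hc x hx, sub_add_cancel, evolution_inv_apply hB hx₀ (hs0 hx)]

theorem evolution_change_base {a : ℝ} (ha : 0 < a) {x : ℝ} (hx : 0 < x) :
    evolution A B a x = evolution A B x₀ x * evolutionInv A B x₀ a := by
  ext v
  refine eqOn_Ioi_of_linear (continuousOn_coeff A hB)
    (fun y hy => hasDerivAt_evolution_apply hB ha v hy)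
    (fun y hy => hasDerivAt_evolution_apply hB hx₀ (evolutionInv A B x₀ a v) hy) ha ?_ hx
  rw [evolution_inv_apply hB hx₀ ha, evolution_base hB ha]
  rfl

theorem evolutionInv_change_base {a : ℝ} (ha : 0 < a) {x : ℝ} (hx : 0 < x) :
    evolutionInv A B a x = evolution A B x₀ a * evolutionInv A B x₀ x := by
  have h1 := evolutionInv_mul hB ha hx (A := A)
  rw [evolution_change_base hB hx₀ ha hx] at h1
  calc evolutionInv A B a x = evolutionInv A B a x *
        ((evolution A B x₀ x * (evolutionInv A B x₀ a * evolution A B x₀ a)) *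
          evolutionInv A B x₀ x) := by
        rw [evolutionInv_mul hB hx₀ ha, mul_one, evolution_mul_inv hB hx₀ hx, mul_one]
    _ = (evolutionInv A B a x * (evolution A B x₀ x * evolutionInv A B x₀ a)) *
          (evolution A B x₀ a * evolutionInv A B x₀ x) := by simp only [mul_assoc]
    _ = _ := by rw [h1, one_mul]

end EvolutionBasics

/-! ### Induction on real irreducible factors -/

open Polynomial in
/-- Induction on the irreducible factors of a real polynomial whose complex roots all satisfy a
given condition. -/
theorem real_polynomial_induction {motive : ℝ[X] → Prop} {good : ℂ → Prop}
    (const : ∀ c : ℝ, c ≠ 0 → motive (C c))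
    (linear : ∀ (a : ℝ) (q : ℝ[X]), good a → motive q → motive ((X - C a) * q))
    (quadratic : ∀ (a b : ℝ) (q : ℝ[X]), b ≠ 0 → good ⟨a, b⟩ → motive q →
      motive (((X - C a) ^ 2 + C (b ^ 2)) * q))
    (p : ℝ[X]) (hp : p ≠ 0) (hgood : ∀ z : ℂ, aeval z p = 0 → good z) : motive p := by
  induction hn : p.natDegree using Nat.strong_induction_on generalizing p with
  | _ n ih =>
  subst hn
  by_cases hdeg : p.natDegree = 0
  · obtain ⟨c, rfl⟩ := natDegree_eq_zero.1 hdeg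
    exact const c (by simpa using hp)
  obtain ⟨z, hz⟩ : ∃ z : ℂ, aeval z p = 0 := by
    refine IsAlgClosed.exists_aeval_eq_zero ℂ p fun h => hdeg ?_
    exact natDegree_eq_of_degree_eq_some h
  by_cases him : z.im = 0
  · have hza : z = (z.re : ℂ) := Complex.ext rfl (by simp [him])
    have hroot : p.IsRoot z.re := by
      rw [hza] at hz
      have := (aeval_algebraMap_apply_eq_algebraMap_eval (A := ℂ) z.re p).symm.trans hz
      simpa using this
    obtain ⟨q, rfl⟩ := dvd_iff_isRoot.2 hroot
    have hq : q ≠ 0 := right_ne_zero_of_mul hp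
    refine linear _ q (hza ▸ hgood z hz) (ih q.natDegree ?_ q hq (fun w hw => hgood w ?_) rfl)
    · rw [natDegree_mul (X_sub_C_ne_zero _) hq, natDegree_X_sub_C]
      lia
    · simp [hw]
  · obtain ⟨q, hpq⟩ := p.quadratic_dvd_of_aeval_eq_zero_im_ne_zero hz him
    have he : (X ^ 2 - C (2 * z.re) * X + C (‖z‖ ^ 2) : ℝ[X]) =
        (X - C z.re) ^ 2 + C (z.im ^ 2) := by
      rw [← Complex.normSq_eq_norm_sq, Complex.normSq_apply]
      simp only [map_add, map_mul, map_pow, map_ofNat]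
      ring
    have hdeg2 : ((X - C z.re) ^ 2 + C (z.im ^ 2) : ℝ[X]).natDegree = 2 := by
      rw [natDegree_add_C, natDegree_pow, natDegree_X_sub_C]
    rw [he] at hpq
    subst hpq
    have hq : q ≠ 0 := right_ne_zero_of_mul hp
    refine quadratic _ _ q him (hgood z hz)
      (ih q.natDegree ?_ q hq (fun w hw => hgood w ?_) rfl)
    · rw [natDegree_mul (left_ne_zero_of_mul hp) hq, hdeg2]
      lia
    · simp [hw]

/-! ### Decay at -∞ for constant-coefficient systems -/

section DecayAtBot

variable {E : Type*} [NormedAddCommGroup E] [NormedSpace ℝ E]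

/-- The integrating factor exp(-as) leaves the derivative exp(-as)h(s), whose norm is at most η
exp(-as); the right-hand side is the integral of that bound over [r, t], whatever the sign of a. -/
theorem norm_exp_smul_sub_le {a η r t : ℝ} (ha : a ≠ 0) (hrt : r ≤ t) {w h : ℝ → E}
    (hw : ∀ s ≤ t, HasDerivAt w (a • w s + h s) s) (hh : ∀ s ≤ t, ‖h s‖ ≤ η) :
    ‖Real.exp (-a * t) • w t - Real.exp (-a * r) • w r‖ ≤
      η / a * (Real.exp (-a * r) - Real.exp (-a * t)) := by
  have hexp : ∀ s : ℝ, HasDerivAt (fun s => Real.exp (-a * s)) (-a * Real.exp (-a * s)) s := by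
    intro s
    simpa [mul_comm] using ((hasDerivAt_id s).const_mul (-a)).exp
  have hd : ∀ s ≤ t, HasDerivAt (fun s => Real.exp (-a * s) • w s - Real.exp (-a * r) • w r)
      (Real.exp (-a * s) • h s) s := by
    intro s hs
    refine (((hexp s).smul (hw s hs)).sub_const _).congr_deriv ?_
    module
  refine image_norm_le_of_norm_deriv_right_le_deriv_boundary (a := r) (b := t)
    (f := fun s => Real.exp (-a * s) • w s - Real.exp (-a * r) • w r)
    (f' := fun s => Real.exp (-a * s) • h s)
    (B := fun s => η / a * (Real.exp (-a * r) - Real.exp (-a * s)))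
    (B' := fun s => η / a * (-(-a * Real.exp (-a * s)))) ?_ ?_ ?_ ?_ ?_ ⟨hrt, le_rfl⟩
  · exact fun s hs => (hd s hs.2).continuousAt.continuousWithinAt
  · exact fun s hs => (hd s hs.2.le).hasDerivWithinAt
  · simp
  · exact fun s => ((hexp s).const_sub _).const_mul _
  · intro s hs
    rw [norm_smul, Real.norm_of_nonneg (Real.exp_pos _).le]
    have : η / a * (-(-a * Real.exp (-a * s))) = Real.exp (-a * s) * η := by
      field_simp
    rw [this]
    exact mul_le_mul_of_nonneg_left (hh s hs.2.le) (Real.exp_pos _).le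

theorem tendsto_exp_mul_atBot {c : ℝ} (hc : 0 < c) :
    Tendsto (fun t : ℝ => Real.exp (c * t)) atBot (𝓝 0) :=
  Real.tendsto_exp_atBot.comp (tendsto_id.const_mul_atBot hc)

/-- For a > 0 the homogeneous part decays at -∞ by itself, so w(t) is compared with its value at a
fixed T. For a < -β the homogeneous part grows faster than the bound on w allows, so w(t) is
compared with w(r) as r → -∞ and the boundary term disappears. -/
theorem tendsto_zero_of_scalar_equation {a β : ℝ} (hβ : 0 ≤ β) (ha : 0 < a ∨ a < -β)
    {w h : ℝ → E} (hw : ∀ᶠ t in atBot, HasDerivAt w (a • w t + h t) t)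
    (hbd : ∃ K, ∀ᶠ t in atBot, ‖w t‖ ≤ K * Real.exp (-β * t)) (hh : Tendsto h atBot (𝓝 0)) :
    Tendsto w atBot (𝓝 0) := by
  obtain ⟨K, hK⟩ := hbd
  have ha0 : a ≠ 0 := by rcases ha with h | h <;> [exact h.ne'; linarith]
  have haa : 0 < |a| := abs_pos.2 ha0
  rw [Metric.tendsto_nhds]
  intro ε hε
  -- Chosen so that the forcing contributes at most (ε|a|/2)/|a| = ε/2.
  have hη : 0 < ε * |a| / 2 := by positivity
  have hh' : ∀ᶠ t in atBot, ‖h t‖ ≤ ε * |a| / 2 := by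
    filter_upwards [(tendsto_zero_iff_norm_tendsto_zero.1 hh).eventually (gt_mem_nhds hη)] with t ht
    exact ht.le
  obtain ⟨T, hT⟩ := eventually_atBot.1 (hw.and (hK.and hh'))
  have key : ∀ r t, r ≤ t → t ≤ T → _ := fun r t hrt ht => norm_exp_smul_sub_le (r := r) (t := t)
    ha0 hrt (fun s hs => (hT s (hs.trans ht)).1) (fun s hs => (hT s (hs.trans ht)).2.2)
  simp only [dist_zero_right]
  rcases ha with ha | ha
  · have h1 : Tendsto (fun t => Real.exp (a * t) * ‖Real.exp (-a * T) • w T‖) atBot (𝓝 0) := by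
      simpa using (tendsto_exp_mul_atBot ha).mul_const ‖Real.exp (-a * T) • w T‖
    filter_upwards [h1.eventually (gt_mem_nhds (half_pos hε)), eventually_le_atBot T] with t ht htT
    have h2 := key t T htT le_rfl
    rw [abs_of_pos ha] at h2
    have h3 : ‖Real.exp (-a * t) • w t‖ ≤
        ‖Real.exp (-a * T) • w T‖ + ε / 2 * Real.exp (-a * t) := by
      have h4 := norm_sub_norm_le (Real.exp (-a * t) • w t) (Real.exp (-a * T) • w T)
      rw [norm_sub_rev] at h4
      have h5 : ε * a / 2 / a * (Real.exp (-a * t) - Real.exp (-a * T)) ≤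
          ε / 2 * Real.exp (-a * t) := by
        have : ε * a / 2 / a = ε / 2 := by field_simp
        rw [this]
        nlinarith [Real.exp_pos (-a * T)]
      linarith
    have h6 : ‖w t‖ = Real.exp (a * t) * ‖Real.exp (-a * t) • w t‖ := by
      rw [norm_smul, Real.norm_of_nonneg (Real.exp_pos _).le, ← mul_assoc, ← Real.exp_add]
      simp
    have h7 : Real.exp (a * t) * Real.exp (-a * t) = 1 := by
      rw [← Real.exp_add]; simp
    rw [h6]
    calc _ ≤ Real.exp (a * t) * (‖Real.exp (-a * T) • w T‖ + ε / 2 * Real.exp (-a * t)) :=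
          mul_le_mul_of_nonneg_left h3 (Real.exp_pos _).le
      _ = Real.exp (a * t) * ‖Real.exp (-a * T) • w T‖ +
          ε / 2 * (Real.exp (a * t) * Real.exp (-a * t)) := by ring
      _ < ε := by rw [h7]; linarith
  · filter_upwards [eventually_le_atBot T] with t htT
    have hneg : a < 0 := by linarith
    have h1 : ∀ᶠ r in atBot, ‖w t‖ ≤
        Real.exp (a * t) * (K * Real.exp (-(a + β) * r)) + ε / 2 := by
      filter_upwards [eventually_le_atBot t] with r hr
      have h2 := key r t hr htT
      rw [abs_of_neg hneg] at h2
      have h3 : ‖Real.exp (-a * t) • w t‖ ≤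
          ‖Real.exp (-a * r) • w r‖ + ε / 2 * Real.exp (-a * t) := by
        have h4 := norm_sub_norm_le (Real.exp (-a * t) • w t) (Real.exp (-a * r) • w r)
        have h5 : ε * -a / 2 / a * (Real.exp (-a * r) - Real.exp (-a * t)) ≤
            ε / 2 * Real.exp (-a * t) := by
          have : ε * -a / 2 / a = -(ε / 2) := by field_simp
          rw [this]
          nlinarith [Real.exp_pos (-a * r)]
        linarith
      have h6 : ‖w t‖ = Real.exp (a * t) * ‖Real.exp (-a * t) • w t‖ := by
        rw [norm_smul, Real.norm_of_nonneg (Real.exp_pos _).le, ← mul_assoc, ← Real.exp_add]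
        simp
      have h7 : Real.exp (a * t) * Real.exp (-a * t) = 1 := by
        rw [← Real.exp_add]; simp
      have h8 : ‖Real.exp (-a * r) • w r‖ ≤ K * Real.exp (-(a + β) * r) := by
        rw [norm_smul, Real.norm_of_nonneg (Real.exp_pos _).le]
        calc _ ≤ Real.exp (-a * r) * (K * Real.exp (-β * r)) :=
              mul_le_mul_of_nonneg_left (hT r (hr.trans htT)).2.1 (Real.exp_pos _).le
          _ = K * (Real.exp (-a * r) * Real.exp (-β * r)) := by ring
          _ = _ := by rw [← Real.exp_add]; ring_nf
      rw [h6]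
      calc _ ≤ Real.exp (a * t) * (K * Real.exp (-(a + β) * r) + ε / 2 * Real.exp (-a * t)) :=
            mul_le_mul_of_nonneg_left (h3.trans (by linarith)) (Real.exp_pos _).le
        _ = Real.exp (a * t) * (K * Real.exp (-(a + β) * r)) +
            ε / 2 * (Real.exp (a * t) * Real.exp (-a * t)) := by ring
        _ = _ := by rw [h7, mul_one]
    -- Here -(a + β) > 0, so the boundary term at r vanishes as r → -∞.
    have h2 : Tendsto (fun r => Real.exp (a * t) * (K * Real.exp (-(a + β) * r)) + ε / 2) atBot
        (𝓝 (Real.exp (a * t) * (K * 0) + ε / 2)) :=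
      (((tendsto_exp_mul_atBot (by linarith)).const_mul _).const_mul _).add_const _
    have := ge_of_tendsto h2 h1
    simp at this
    linarith

open Polynomial in
-- The operator T₁ = (N - a)/b plays the role of the imaginary unit for the eigenvalue pair a ± bi.
theorem apply_eq_of_ne_zero (N : E →L[ℝ] E) (a : ℝ) {b : ℝ} (hb : b ≠ 0) (v : E) :
    N v = a • v + b • aeval N (C b⁻¹ * (X - C a)) v := by
  simp [Algebra.algebraMap_eq_smul_one, smul_smul, mul_inv_cancel₀ hb]

open Polynomial in
-- With T = (N - a)² + b² one has T₁² = -1 + b⁻²T: the imaginary unit up to an error carried by T,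
-- which the inductions treat as forcing.
theorem apply_linear_factor_eq (N : E →L[ℝ] E) (a : ℝ) {b : ℝ} (hb : b ≠ 0) (v : E) :
    N (aeval N (C b⁻¹ * (X - C a)) v) = a • aeval N (C b⁻¹ * (X - C a)) v - b • v +
      b⁻¹ • aeval N ((X - C a) ^ 2 + C (b ^ 2)) v := by
  set T : E →L[ℝ] E := aeval N ((X - C a) ^ 2 + C (b ^ 2)) with hTdef
  set T₁ : E →L[ℝ] E := aeval N (C b⁻¹ * (X - C a)) with hT₁def
  have h1 : T = b ^ 2 • (T₁ * T₁) + b ^ 2 • 1 := by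
    have : (X - C a) ^ 2 + C (b ^ 2) =
        C (b ^ 2) * ((C b⁻¹ * (X - C a)) * (C b⁻¹ * (X - C a))) + C (b ^ 2) := by
      have h2 : (C b * C b⁻¹ : ℝ[X]) = 1 := by rw [← C_mul, mul_inv_cancel₀ hb, C_1]
      simp only [C_pow]
      linear_combination (-(X - C a) ^ 2 * (C b * C b⁻¹ + 1)) * h2
    rw [hTdef, this]
    simp only [map_add, map_mul, aeval_C, Algebra.algebraMap_eq_smul_one, hT₁def]
    simp only [smul_mul_assoc, one_mul]
  have h2 : T v = b ^ 2 • T₁ (T₁ v) + b ^ 2 • v := by rw [h1]; simp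
  rw [apply_eq_of_ne_zero N a hb (T₁ v), ← hT₁def, h2]
  match_scalars <;> field_simp
  ring

open Polynomial in
/-- A solution of `z' = N z + f` that does not grow faster than `exp (-β t)` as `t → -∞` tends to
zero if `f` does and `N` has no eigenvalue with real part in `[-β, 0]`. -/
theorem tendsto_zero_of_equation {N : E →L[ℝ] E} {p : ℝ[X]} (hp : p ≠ 0) (hpN : aeval N p = 0)
    {β : ℝ} (hβ : 0 ≤ β) (hroots : ∀ z : ℂ, aeval z p = 0 → 0 < z.re ∨ z.re < -β)
    {z f : ℝ → E} (hz : ∀ᶠ t in atBot, HasDerivAt z (N (z t) + f t) t)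
    (hbd : ∃ K, ∀ᶠ t in atBot, ‖z t‖ ≤ K * Real.exp (-β * t)) (hf : Tendsto f atBot (𝓝 0)) :
    Tendsto z atBot (𝓝 0) := by
  have hbdT : ∀ (T : E →L[ℝ] E) (z : ℝ → E), (∃ K, ∀ᶠ t in atBot, ‖z t‖ ≤ K * Real.exp (-β * t)) →
      ∃ K, ∀ᶠ t in atBot, ‖T (z t)‖ ≤ K * Real.exp (-β * t) := by
    rintro T z ⟨K, hK⟩
    refine ⟨‖T‖ * K, ?_⟩
    filter_upwards [hK] with t ht
    calc _ ≤ ‖T‖ * ‖z t‖ := T.le_opNorm _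
      _ ≤ ‖T‖ * (K * Real.exp (-β * t)) := mul_le_mul_of_nonneg_left ht (norm_nonneg _)
      _ = _ := by ring
  have hT0 : ∀ (T : E →L[ℝ] E) (z : ℝ → E), Tendsto z atBot (𝓝 0) →
      Tendsto (fun t => T (z t)) atBot (𝓝 0) := by
    intro T z hz
    exact (T.continuous.tendsto' 0 0 (map_zero T)).comp hz
  have hTd : ∀ (T : E →L[ℝ] E), Commute T N → ∀ z f : ℝ → E,
      (∀ᶠ t in atBot, HasDerivAt z (N (z t) + f t) t) →
      ∀ᶠ t in atBot, HasDerivAt (fun t => T (z t)) (N (T (z t)) + T (f t)) t := by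
    intro T hT z f hz
    filter_upwards [hz] with t ht
    refine (T.hasFDerivAt.comp_hasDerivAt t ht).congr_deriv ?_
    rw [map_add]
    congr 1
    exact DFunLike.congr_fun hT (z t)
  -- Weakening p(N) = 0 to p(N)z → 0 makes the claim inductive: a factor removed from p is absorbed
  -- into z.
  suffices H : ∀ z f : ℝ → E, (∀ᶠ t in atBot, HasDerivAt z (N (z t) + f t) t) →
      (∃ K, ∀ᶠ t in atBot, ‖z t‖ ≤ K * Real.exp (-β * t)) → Tendsto f atBot (𝓝 0) →
      Tendsto (fun t => aeval N p (z t)) atBot (𝓝 0) → Tendsto z atBot (𝓝 0) from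
    H z f hz hbd hf (by simp [hpN])
  refine real_polynomial_induction (good := fun z => 0 < z.re ∨ z.re < -β)
    (motive := fun p => ∀ z f : ℝ → E, (∀ᶠ t in atBot, HasDerivAt z (N (z t) + f t) t) →
      (∃ K, ∀ᶠ t in atBot, ‖z t‖ ≤ K * Real.exp (-β * t)) → Tendsto f atBot (𝓝 0) →
      Tendsto (fun t => aeval N p (z t)) atBot (𝓝 0) → Tendsto z atBot (𝓝 0)) ?_ ?_ ?_ p hp hroots
  · intro c hc z f _ _ _ h
    have := h.const_smul c⁻¹
    simpa [Algebra.algebraMap_eq_smul_one, smul_smul, inv_mul_cancel₀ hc] using this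
  · intro a q ha ih z f hz hbd hf hq
    set T : E →L[ℝ] E := aeval N (X - C a) with hTdef
    have hcomm : Commute T N := by
      have := (Commute.all (X - C a) (X : ℝ[X])).map (aeval N)
      simpa only [aeval_X] using this
    -- The function (N - a)z solves the same kind of equation and is killed asymptotically by q(N);
    -- once it tends to zero it is mere forcing in z' = az + (N - a)z + f.
    have h0 : Tendsto (fun t => T (z t)) atBot (𝓝 0) := by
      refine ih _ _ (hTd T hcomm z f hz) (hbdT T z hbd) (hT0 T f hf) ?_
      have : ∀ t, aeval N q (T (z t)) = aeval N ((X - C a) * q) (z t) := by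
        intro t
        rw [mul_comm, map_mul]
        rfl
      simpa only [this] using hq
    refine tendsto_zero_of_scalar_equation hβ (a := a) (h := fun t => T (z t) + f t)
      (by simpa using ha) ?_ hbd (by simpa using h0.add hf)
    filter_upwards [hz] with t ht
    refine ht.congr_deriv ?_
    simp only [hTdef, map_sub, aeval_X, aeval_C, Algebra.algebraMap_eq_smul_one, sub_apply,
      smul_apply, one_apply_eq_self]
    module
  · intro a b q hb ha ih z f hz hbd hf hq
    set T : E →L[ℝ] E := aeval N ((X - C a) ^ 2 + C (b ^ 2)) with hTdef
    set T₁ : E →L[ℝ] E := aeval N (C b⁻¹ * (X - C a)) with hT₁def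
    have hcomm : Commute T N := by
      have := (Commute.all ((X - C a) ^ 2 + C (b ^ 2)) (X : ℝ[X])).map (aeval N)
      simpa only [aeval_X] using this
    have hcomm₁ : Commute T₁ N := by
      have := (Commute.all (C b⁻¹ * (X - C a)) (X : ℝ[X])).map (aeval N)
      simpa only [aeval_X] using this
    have h0 : Tendsto (fun t => T (z t)) atBot (𝓝 0) := by
      refine ih _ _ (hTd T hcomm z f hz) (hbdT T z hbd) (hT0 T f hf) ?_
      have : ∀ t, aeval N q (T (z t)) = aeval N (((X - C a) ^ 2 + C (b ^ 2)) * q) (z t) := by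
        intro t
        rw [mul_comm, map_mul]
        rfl
      simpa only [this] using hq
    have hNz : ∀ v, N v = a • v + b • T₁ v := apply_eq_of_ne_zero N a hb
    have hNT : ∀ v, N (T₁ v) = a • T₁ v - b • v + b⁻¹ • T v := apply_linear_factor_eq N a hb
    have hk : Tendsto (fun t => b⁻¹ • T (z t) + T₁ (f t)) atBot (𝓝 0) := by
      simpa using (h0.const_smul b⁻¹).add (hT0 T₁ f hf)
    have hdz₁ := hTd T₁ hcomm₁ z f hz
    obtain ⟨K, hK⟩ := hbd
    obtain ⟨K₁, hK₁⟩ := hbdT T₁ z ⟨K, hK⟩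
    have hsin : ∀ t : ℝ, HasDerivAt (fun t => Real.sin (b * t)) (b * Real.cos (b * t)) t := by
      intro t
      simpa [mul_comm] using ((hasDerivAt_id t).const_mul b).sin
    have hcos : ∀ t : ℝ, HasDerivAt (fun t => Real.cos (b * t)) (-(b * Real.sin (b * t))) t := by
      intro t
      simpa [mul_comm] using ((hasDerivAt_id t).const_mul b).cos
    have hb1 : ∀ (c : ℝ) (v : E), |c| ≤ 1 → ‖c • v‖ ≤ ‖v‖ := by
      intro c v hc
      rw [norm_smul]
      exact mul_le_of_le_one_left (norm_nonneg _) hc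
    have hlim : ∀ (φ : ℝ → ℝ) (w : ℝ → E), (∀ t, |φ t| ≤ 1) → Tendsto w atBot (𝓝 0) →
        Tendsto (fun t => φ t • w t) atBot (𝓝 0) := by
      intro φ w hφ hw
      exact squeeze_zero_norm (fun t => hb1 _ _ (hφ t)) (tendsto_zero_iff_norm_tendsto_zero.1 hw)
    have hs1 : ∀ t : ℝ, |Real.sin (b * t)| ≤ 1 := fun t => Real.abs_sin_le_one _
    have hc1 : ∀ t : ℝ, |Real.cos (b * t)| ≤ 1 := fun t => Real.abs_cos_le_one _
    have hbound : ∀ φ ψ : ℝ → ℝ, (∀ t, |φ t| ≤ 1) → (∀ t, |ψ t| ≤ 1) →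
        ∀ᶠ t in atBot, ‖φ t • z t + ψ t • T₁ (z t)‖ ≤ (K + K₁) * Real.exp (-β * t) := by
      intro φ ψ hφ hψ
      filter_upwards [hK, hK₁] with t h1 h2
      calc _ ≤ ‖φ t • z t‖ + ‖ψ t • T₁ (z t)‖ := norm_add_le _ _
        _ ≤ ‖z t‖ + ‖T₁ (z t)‖ := add_le_add (hb1 _ _ (hφ t)) (hb1 _ _ (hψ t))
        _ ≤ _ := by rw [add_mul]; exact add_le_add h1 h2
    -- This and the next combination are, up to sign, the real and imaginary parts of exp(-ibt)(z -
    -- iT₁z). The rotation removes the imaginary part of the eigenvalue, leaving scalar equations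
    -- with coefficient a.
    have hP : Tendsto (fun t => Real.cos (b * t) • z t + (-Real.sin (b * t)) • T₁ (z t)) atBot
        (𝓝 0) := by
      refine tendsto_zero_of_scalar_equation hβ (a := a) (h := fun t => Real.cos (b * t) • f t +
        (-Real.sin (b * t)) • (b⁻¹ • T (z t) + T₁ (f t))) ha ?_
        ⟨_, hbound _ _ hc1 (by simpa using hs1)⟩ ?_
      · filter_upwards [hz, hdz₁] with t h1 h2
        refine (((hcos t).smul h1).add ((hsin t).fun_neg.smul h2)).congr_deriv ?_
        rw [hNT, hNz]
        module
      · simpa using (hlim _ _ hc1 hf).add (hlim (fun t => -Real.sin (b * t)) _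
          (by simpa using hs1) hk)
    have hQ : Tendsto (fun t => Real.sin (b * t) • z t + Real.cos (b * t) • T₁ (z t)) atBot
        (𝓝 0) := by
      refine tendsto_zero_of_scalar_equation hβ (a := a) (h := fun t => Real.sin (b * t) • f t +
        Real.cos (b * t) • (b⁻¹ • T (z t) + T₁ (f t))) ha ?_ ⟨_, hbound _ _ hs1 hc1⟩ ?_
      · filter_upwards [hz, hdz₁] with t h1 h2
        refine (((hsin t).smul h1).add ((hcos t).smul h2)).congr_deriv ?_
        rw [hNT, hNz]
        module
      · simpa using (hlim _ _ hs1 hf).add (hlim _ _ hc1 hk)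
    have := (hlim _ _ hc1 hP).add (hlim _ _ hs1 hQ)
    rw [add_zero] at this
    refine this.congr fun t => ?_
    have h1 := Real.sin_sq_add_cos_sq (b * t)
    calc _ = (Real.sin (b * t) ^ 2 + Real.cos (b * t) ^ 2) • z t := by module
      _ = z t := by rw [h1, one_smul]

end DecayAtBot

/-! ### Bounded solutions on the whole line -/

section BoundedSolutions

open BoundedContinuousFunction (ofNormedAddCommGroup norm_ofNormedAddCommGroup_le)
open scoped BoundedContinuousFunction

variable {E : Type*} [NormedAddCommGroup E] [NormedSpace ℝ E]

/-- Pointwise application of a bounded continuous family of operators. -/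
noncomputable def pointwiseApply (P : ℝ →ᵇ (E →L[ℝ] E)) : (ℝ →ᵇ E) →L[ℝ] (ℝ →ᵇ E) :=
  LinearMap.mkContinuous
    { toFun := fun f => ofNormedAddCommGroup (fun t => P t (f t))
        (P.continuous.clm_apply f.continuous) (‖P‖ * ‖f‖) fun t => (P t).le_of_opNorm_le_of_le
          (P.norm_coe_le_norm t) (f.norm_coe_le_norm t)
      map_add' := fun f g => by ext t; simp
      map_smul' := fun c f => by ext t; simp }
    ‖P‖ fun f => norm_ofNormedAddCommGroup_le _ (by positivity) fun t =>
      (P t).le_of_opNorm_le_of_le (P.norm_coe_le_norm t) (f.norm_coe_le_norm t)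

@[simp]
theorem pointwiseApply_apply (P : ℝ →ᵇ (E →L[ℝ] E)) (f : ℝ →ᵇ E) (t : ℝ) :
    pointwiseApply P f t = P t (f t) := rfl

theorem norm_pointwiseApply_le (P : ℝ →ᵇ (E →L[ℝ] E)) : ‖pointwiseApply P‖ ≤ ‖P‖ :=
  LinearMap.mkContinuous_norm_le _ (norm_nonneg P) _

theorem continuous_exp_neg_smul (a : ℝ) (f : ℝ →ᵇ E) :
    Continuous fun s : ℝ => Real.exp (-a * s) • f s := by fun_prop

theorem norm_exp_neg_smul_le (a : ℝ) (f : ℝ →ᵇ E) (s : ℝ) :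
    ‖Real.exp (-a * s) • f s‖ ≤ ‖f‖ * Real.exp (-a * s) := by
  rw [norm_smul, Real.norm_of_nonneg (Real.exp_pos _).le, mul_comm]
  exact mul_le_mul_of_nonneg_right (f.norm_coe_le_norm s) (Real.exp_pos _).le

/-- The bounded solution of u' = au + f is an integral from -∞ if a < 0 and from +∞ if a > 0.
Commutation with constant operators T is recorded because the induction over polynomial factors must
preserve the relation q(N)(N - a)f = 0. -/
theorem exists_resolvent [CompleteSpace E] {a : ℝ} (ha : a ≠ 0) :
    ∃ R : (ℝ →ᵇ E) →L[ℝ] (ℝ →ᵇ E),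
      (∀ (T : E →L[ℝ] E) (f : ℝ →ᵇ E), R (T.compLeftContinuousBounded ℝ f) =
        T.compLeftContinuousBounded ℝ (R f)) ∧
      ∀ (f : ℝ →ᵇ E) (t : ℝ), HasDerivAt (R f) (a • R f t + f t) t := by
  -- J is the resolvent without its prefactor exp(at); isolating it confines the sign distinction to
  -- this step.
  have hint : ∃ J : (ℝ →ᵇ E) → ℝ → E,
      (∀ (T : E →L[ℝ] E) f t, J (T.compLeftContinuousBounded ℝ f) t = T (J f t)) ∧
      (∀ f g t, J (f + g) t = J f t + J g t) ∧ (∀ (c : ℝ) f t, J (c • f) t = c • J f t) ∧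
      (∀ f t, ‖J f t‖ ≤ ‖f‖ * (Real.exp (-a * t) / |a|)) ∧
      ∀ f t, HasDerivAt (J f) (Real.exp (-a * t) • f t) t := by
    rcases lt_or_gt_of_ne ha with h | h
    · have hi : ∀ f : ℝ →ᵇ E, ∀ t, IntegrableOn (fun s => Real.exp (-a * s) • f s) (Iic t) :=
        fun f t => ((integrableOn_exp_mul_Iic (neg_pos.2 h) t).const_mul ‖f‖).mono'
          (continuous_exp_neg_smul a f).aestronglyMeasurable
          (ae_of_all _ (norm_exp_neg_smul_le a f))
      refine ⟨fun f t => ∫ s in Iic t, Real.exp (-a * s) • f s, ?_, ?_, ?_, ?_, ?_⟩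
      · intro T f t
        rw [← T.integral_comp_comm (hi f t)]
        simp
      · intro f g t
        rw [← integral_add (hi f t) (hi g t)]
        simp
      · intro c f t
        rw [← integral_smul]
        simp only [BoundedContinuousFunction.coe_smul, smul_comm c]
      · intro f t
        calc _ ≤ ∫ s in Iic t, ‖f‖ * Real.exp (-a * s) :=
              norm_integral_le_of_norm_le ((integrableOn_exp_mul_Iic (neg_pos.2 h) t).const_mul _)
                (ae_of_all _ (norm_exp_neg_smul_le a f))
          _ = _ := by rw [integral_const_mul, integral_exp_mul_Iic (neg_pos.2 h), abs_of_neg h]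
      · intro f t
        have h1 : (fun t => ∫ s in Iic t, Real.exp (-a * s) • f s) = fun t =>
            (∫ s in Iic (0 : ℝ), Real.exp (-a * s) • f s) +
              ∫ s in (0 : ℝ)..t, Real.exp (-a * s) • f s := by
          ext t
          rw [← intervalIntegral.integral_Iic_sub_Iic (hi f 0) (hi f t), add_sub_cancel]
        change HasDerivAt (fun t => _) _ t
        rw [h1]
        exact ((continuous_exp_neg_smul a f).integral_hasStrictDerivAt 0 t).hasDerivAt.const_add _
    · have hi : ∀ f : ℝ →ᵇ E, ∀ t, IntegrableOn (fun s => Real.exp (-a * s) • f s) (Ioi t) :=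
        fun f t => ((integrableOn_exp_mul_Ioi (neg_lt_zero.2 h) t).const_mul ‖f‖).mono'
          (continuous_exp_neg_smul a f).aestronglyMeasurable
          (ae_of_all _ (norm_exp_neg_smul_le a f))
      refine ⟨fun f t => -∫ s in Ioi t, Real.exp (-a * s) • f s, ?_, ?_, ?_, ?_, ?_⟩
      · intro T f t
        rw [map_neg, ← T.integral_comp_comm (hi f t)]
        simp
      · intro f g t
        rw [← neg_add, ← integral_add (hi f t) (hi g t)]
        simp
      · intro c f t
        rw [smul_neg, ← integral_smul]
        simp only [BoundedContinuousFunction.coe_smul, smul_comm c]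
      · intro f t
        rw [norm_neg]
        calc _ ≤ ∫ s in Ioi t, ‖f‖ * Real.exp (-a * s) :=
              norm_integral_le_of_norm_le
                ((integrableOn_exp_mul_Ioi (neg_lt_zero.2 h) t).const_mul _)
                (ae_of_all _ (norm_exp_neg_smul_le a f))
          _ = _ := by
              rw [integral_const_mul, integral_exp_mul_Ioi (neg_lt_zero.2 h), abs_of_pos h,
                neg_div_neg_eq]
      · intro f t
        have h1 : (fun t => -∫ s in Ioi t, Real.exp (-a * s) • f s) = fun t =>
            -(∫ s in Ioi (0 : ℝ), Real.exp (-a * s) • f s) +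
              ∫ s in (0 : ℝ)..t, Real.exp (-a * s) • f s := by
          ext t
          rw [← intervalIntegral.integral_interval_add_Ioi (hi f 0) (hi f t)]
          abel
        change HasDerivAt (fun t => _) _ t
        rw [h1]
        exact ((continuous_exp_neg_smul a f).integral_hasStrictDerivAt 0 t).hasDerivAt.const_add _
  obtain ⟨J, hJT, hJadd, hJsmul, hJle, hJd⟩ := hint
  have hexp : ∀ s : ℝ, HasDerivAt (fun s => Real.exp (a * s)) (a * Real.exp (a * s)) s := by
    intro s
    simpa [mul_comm] using ((hasDerivAt_id s).const_mul a).exp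
  have hone : ∀ t, Real.exp (a * t) * Real.exp (-a * t) = 1 := by
    intro t; rw [← Real.exp_add]; simp
  have hd : ∀ f t, HasDerivAt (fun t => Real.exp (a * t) • J f t)
      (a • Real.exp (a * t) • J f t + f t) t := by
    intro f t
    refine ((hexp t).smul (hJd f t)).congr_deriv ?_
    rw [smul_smul, hone, one_smul]
    module
  have hle : ∀ f t, ‖Real.exp (a * t) • J f t‖ ≤ |a|⁻¹ * ‖f‖ := by
    intro f t
    rw [norm_smul, Real.norm_of_nonneg (Real.exp_pos _).le]
    calc _ ≤ Real.exp (a * t) * (‖f‖ * (Real.exp (-a * t) / |a|)) :=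
          mul_le_mul_of_nonneg_left (hJle f t) (Real.exp_pos _).le
      _ = (Real.exp (a * t) * Real.exp (-a * t)) * (|a|⁻¹ * ‖f‖) := by ring
      _ = _ := by rw [hone, one_mul]
  refine ⟨LinearMap.mkContinuous
    { toFun := fun f => ofNormedAddCommGroup (fun t => Real.exp (a * t) • J f t)
        (continuous_iff_continuousAt.2 fun t => (hd f t).continuousAt) (|a|⁻¹ * ‖f‖) (hle f)
      map_add' := fun f g => by ext t; simp [hJadd]
      map_smul' := fun c f => by ext t; simp [hJsmul, smul_comm c] }
    |a|⁻¹ fun f => norm_ofNormedAddCommGroup_le _ (by positivity) (hle f), ?_, fun f t => hd f t⟩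
  intro T f
  ext t
  simp [hJT]

/-- Resolvent for a pair of complex conjugate eigenvalues `a ± b i`. -/
theorem exists_resolvent_pair [CompleteSpace E] {a : ℝ} (ha : a ≠ 0) (b : ℝ) :
    ∃ U V : (ℝ →ᵇ E) →L[ℝ] (ℝ →ᵇ E),
      (∀ (T : E →L[ℝ] E) (f : ℝ →ᵇ E), V (T.compLeftContinuousBounded ℝ f) =
        T.compLeftContinuousBounded ℝ (V f)) ∧
      ∀ (f : ℝ →ᵇ E) (t : ℝ), HasDerivAt (U f) (a • U f t - b • V f t + f t) t ∧
        HasDerivAt (V f) (b • U f t + a • V f t) t := by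
  obtain ⟨R, hRT, hRd⟩ := exists_resolvent (E := E) ha
  have hone : ‖(1 : E →L[ℝ] E)‖ ≤ 1 := ContinuousLinearMap.norm_id_le
  have hle : ∀ c : ℝ, |c| ≤ 1 → ‖c • (1 : E →L[ℝ] E)‖ ≤ 1 := by
    intro c hc
    rw [norm_smul]
    exact mul_le_one₀ hc (norm_nonneg _) hone
  let Cb : ℝ →ᵇ (E →L[ℝ] E) := ofNormedAddCommGroup
    (fun t => Real.cos (b * t) • (1 : E →L[ℝ] E)) (by fun_prop) 1
    fun t => hle _ (Real.abs_cos_le_one _)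
  let Sb : ℝ →ᵇ (E →L[ℝ] E) := ofNormedAddCommGroup
    (fun t => Real.sin (b * t) • (1 : E →L[ℝ] E)) (by fun_prop) 1
    fun t => hle _ (Real.abs_sin_le_one _)
  have hC : ∀ f t, pointwiseApply Cb f t = Real.cos (b * t) • f t := fun f t => by
    simp [Cb]
  have hS : ∀ f t, pointwiseApply Sb f t = Real.sin (b * t) • f t := fun f t => by
    simp [Sb]
  have hCT : ∀ (T : E →L[ℝ] E) f, pointwiseApply Cb (T.compLeftContinuousBounded ℝ f) =
      T.compLeftContinuousBounded ℝ (pointwiseApply Cb f) := by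
    intro T f; ext t; simp [hC]
  have hST : ∀ (T : E →L[ℝ] E) f, pointwiseApply Sb (T.compLeftContinuousBounded ℝ f) =
      T.compLeftContinuousBounded ℝ (pointwiseApply Sb f) := by
    intro T f; ext t; simp [hS]
  have hsin : ∀ t : ℝ, HasDerivAt (fun t => Real.sin (b * t)) (b * Real.cos (b * t)) t := by
    intro t
    simpa [mul_comm] using ((hasDerivAt_id t).const_mul b).sin
  have hcos : ∀ t : ℝ, HasDerivAt (fun t => Real.cos (b * t)) (-(b * Real.sin (b * t))) t := by
    intro t
    simpa [mul_comm] using ((hasDerivAt_id t).const_mul b).cos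
  -- U and V are the real and imaginary parts of f ↦ exp(ibt)R(exp(-ibt)f), the complex resolvent
  -- for a + bi.
  refine ⟨pointwiseApply Cb ∘L R ∘L pointwiseApply Cb + pointwiseApply Sb ∘L R ∘L pointwiseApply Sb,
    pointwiseApply Sb ∘L R ∘L pointwiseApply Cb - pointwiseApply Cb ∘L R ∘L pointwiseApply Sb,
    ?_, ?_⟩
  · intro T f
    simp only [sub_apply, ContinuousLinearMap.comp_apply, hCT, hST, hRT, map_sub]
  · intro f t
    set p := R (pointwiseApply Cb f)
    set q := R (pointwiseApply Sb f)
    have hp : HasDerivAt p (a • p t + Real.cos (b * t) • f t) t := by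
      simpa only [hC] using hRd (pointwiseApply Cb f) t
    have hq : HasDerivAt q (a • q t + Real.sin (b * t) • f t) t := by
      simpa only [hS] using hRd (pointwiseApply Sb f) t
    have h1 := Real.sin_sq_add_cos_sq (b * t)
    have hf : f t = (Real.sin (b * t) ^ 2 + Real.cos (b * t) ^ 2) • f t := by rw [h1, one_smul]
    constructor
    · have : ⇑((pointwiseApply Cb ∘L R ∘L pointwiseApply Cb +
          pointwiseApply Sb ∘L R ∘L pointwiseApply Sb) f) =
          fun t => Real.cos (b * t) • p t + Real.sin (b * t) • q t := by
        ext t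
        simp [p, q, hC, hS]
      rw [this]
      refine (((hcos t).smul hp).add ((hsin t).smul hq)).congr_deriv ?_
      conv_rhs => rw [hf]
      simp only [sub_apply, ContinuousLinearMap.comp_apply, BoundedContinuousFunction.coe_sub, Pi.sub_apply, hC, hS]
      simp only [p, q]
      module
    · have : ⇑((pointwiseApply Sb ∘L R ∘L pointwiseApply Cb -
          pointwiseApply Cb ∘L R ∘L pointwiseApply Sb) f) =
          fun t => Real.sin (b * t) • p t - Real.cos (b * t) • q t := by
        ext t
        simp [p, q, hC, hS]
      rw [this]
      refine (((hsin t).smul hp).sub ((hcos t).smul hq)).congr_deriv ?_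
      simp only [add_apply, ContinuousLinearMap.comp_apply, BoundedContinuousFunction.coe_add, Pi.add_apply, hC, hS]
      simp only [p, q]
      module

open Polynomial in
/-- If `N` has no purely imaginary eigenvalue, then `u' = N u + f` has a bounded solution for every
bounded continuous `f`, depending on `f` linearly and continuously. -/
theorem exists_solution_operator [CompleteSpace E] {N : E →L[ℝ] E} {p : ℝ[X]} (hp : p ≠ 0)
    (hpN : aeval N p = 0) (hroots : ∀ z : ℂ, aeval z p = 0 → z.re ≠ 0) :
    ∃ S : (ℝ →ᵇ E) →L[ℝ] (ℝ →ᵇ E), ∀ f t, HasDerivAt (S f) (N (S f t) + f t) t := by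
  -- For the induction S need only solve the equation for those f annihilated by p(N).
  suffices H : ∃ S : (ℝ →ᵇ E) →L[ℝ] (ℝ →ᵇ E), ∀ f,
      (aeval N p).compLeftContinuousBounded ℝ f = 0 →
        ∀ t, HasDerivAt (S f) (N (S f t) + f t) t by
    obtain ⟨S, hS⟩ := H
    exact ⟨S, fun f => hS f (by ext t; simp [hpN])⟩
  refine real_polynomial_induction (good := fun z => z.re ≠ 0)
    (motive := fun p => ∃ S : (ℝ →ᵇ E) →L[ℝ] (ℝ →ᵇ E), ∀ f,
      (aeval N p).compLeftContinuousBounded ℝ f = 0 →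
        ∀ t, HasDerivAt (S f) (N (S f t) + f t) t) ?_ ?_ ?_ p hp hroots
  · intro c hc
    refine ⟨0, fun f hf t => ?_⟩
    have h0 : f t = 0 := by
      have : c • f t = 0 := by
        simpa [Algebra.algebraMap_eq_smul_one] using DFunLike.congr_fun hf t
      exact (smul_eq_zero.1 this).resolve_left hc
    simp [h0]
  · rintro a q ha ⟨S, hS⟩
    obtain ⟨R, hRT, hRd⟩ := exists_resolvent (E := E) (a := a) (by simpa using ha)
    set T : E →L[ℝ] E := aeval N (X - C a) with hTdef
    -- Rf solves the equation up to the error (N - a)Rf, which is annihilated by q(N) and so can be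
    -- corrected by S.
    refine ⟨R + S ∘L T.compLeftContinuousBounded ℝ ∘L R, fun f hf t => ?_⟩
    have h1 : (aeval N q).compLeftContinuousBounded ℝ (T.compLeftContinuousBounded ℝ (R f)) = 0 := by
      have : (aeval N q).compLeftContinuousBounded ℝ (T.compLeftContinuousBounded ℝ (R f)) =
          (aeval N ((X - C a) * q)).compLeftContinuousBounded ℝ (R f) := by
        ext t
        rw [mul_comm, map_mul]
        rfl
      rw [this, ← hRT, hf, map_zero]
    refine ((hRd f t).add (hS _ h1 t)).congr_deriv ?_
    have hT : ∀ v, T v = N v - a • v := fun v => by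
      simp [hTdef, Algebra.algebraMap_eq_smul_one]
    simp only [add_apply, ContinuousLinearMap.comp_apply, BoundedContinuousFunction.coe_add, Pi.add_apply, map_add,
      ContinuousLinearMap.compLeftContinuousBounded_apply, hT]
    abel
  · rintro a b q hb ha ⟨S, hS⟩
    obtain ⟨U, V, hVT, hUV⟩ := exists_resolvent_pair (E := E) (a := a) (by simpa using ha) b
    set T : E →L[ℝ] E := aeval N ((X - C a) ^ 2 + C (b ^ 2)) with hTdef
    set T₁ : E →L[ℝ] E := aeval N (C b⁻¹ * (X - C a)) with hT₁def
    have hNz : ∀ v, N v = a • v + b • T₁ v := apply_eq_of_ne_zero N a hb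
    have hNT : ∀ v, N (T₁ v) = a • T₁ v - b • v + b⁻¹ • T v := apply_linear_factor_eq N a hb
    -- With T₁ for the imaginary unit, Uf + T₁Vf misses the equation only by b⁻¹TVf, which q(N)
    -- annihilates and S corrects.
    refine ⟨U + T₁.compLeftContinuousBounded ℝ ∘L V +
      b⁻¹ • (S ∘L T.compLeftContinuousBounded ℝ ∘L V), fun f hf t => ?_⟩
    have h1 : (aeval N q).compLeftContinuousBounded ℝ (T.compLeftContinuousBounded ℝ (V f)) = 0 := by
      have : (aeval N q).compLeftContinuousBounded ℝ (T.compLeftContinuousBounded ℝ (V f)) =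
          (aeval N (((X - C a) ^ 2 + C (b ^ 2)) * q)).compLeftContinuousBounded ℝ (V f) := by
        ext t
        rw [mul_comm, map_mul]
        rfl
      rw [this, ← hVT, hf, map_zero]
    refine (((hUV f t).1.add (T₁.hasFDerivAt.comp_hasDerivAt t (hUV f t).2)).add
      ((hS _ h1 t).const_smul b⁻¹)).congr_deriv ?_
    simp only [add_apply, smul_apply, ContinuousLinearMap.comp_apply, BoundedContinuousFunction.coe_add,
      BoundedContinuousFunction.coe_smul,
      Pi.add_apply, map_add, map_smul, ContinuousLinearMap.compLeftContinuousBounded_apply, hNT,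
      hNz (U f t)]
    module

open Polynomial in
/-- The equation `u' = (N + P(t)) u + f`, with `N` free of purely imaginary eigenvalues and `P`
small, has a bounded solution for every bounded continuous `f`. -/
theorem exists_bounded_solution [CompleteSpace E] {N : E →L[ℝ] E} {p : ℝ[X]} (hp : p ≠ 0)
    (hpN : aeval N p = 0) (hroots : ∀ z : ℂ, aeval z p = 0 → z.re ≠ 0) :
    ∃ ε > 0, ∃ K : ℝ, ∀ P : ℝ →ᵇ (E →L[ℝ] E), ‖P‖ ≤ ε → ∀ f : ℝ →ᵇ E, ∃ u : ℝ →ᵇ E,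
      ‖u‖ ≤ K * ‖f‖ ∧ ∀ t, HasDerivAt u (N (u t) + P t (u t) + f t) t := by
  obtain ⟨S, hS⟩ := exists_solution_operator hp hpN hroots
  -- A solution is a fixed point of u = S(Pu + f). This ε gives ‖SP‖ ≤ 1/2, so 1 - SP is invertible
  -- and ‖u‖ ≤ 2‖S‖‖f‖.
  refine ⟨(2 * (‖S‖ + 1))⁻¹, by positivity, 2 * ‖S‖, fun P hP f => ?_⟩
  set Q := S ∘L pointwiseApply P
  have hQ : ‖Q‖ ≤ 1 / 2 := by
    calc ‖Q‖ ≤ ‖S‖ * ‖pointwiseApply P‖ := ContinuousLinearMap.opNorm_comp_le _ _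
      _ ≤ (‖S‖ + 1) * (2 * (‖S‖ + 1))⁻¹ := by
        gcongr
        · linarith
        · exact (norm_pointwiseApply_le P).trans hP
      _ = 1 / 2 := by field_simp
  have hQ1 : ‖Q‖ < 1 := by linarith
  set u := (↑(Units.oneSub Q hQ1)⁻¹ : (ℝ →ᵇ E) →L[ℝ] (ℝ →ᵇ E)) (S f) with hu
  have h1 : u = Q u + S f := by
    have : (↑(Units.oneSub Q hQ1) : (ℝ →ᵇ E) →L[ℝ] (ℝ →ᵇ E)) u = S f := by
      exact DFunLike.congr_fun (Units.mul_inv (Units.oneSub Q hQ1)) (S f)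
    rw [Units.val_oneSub] at this
    rw [← this]
    simp
  refine ⟨u, ?_, fun t => ?_⟩
  · have h2 : ‖u‖ ≤ 1 / 2 * ‖u‖ + ‖S‖ * ‖f‖ := by
      calc ‖u‖ = ‖Q u + S f‖ := by rw [← h1]
        _ ≤ ‖Q u‖ + ‖S f‖ := norm_add_le _ _
        _ ≤ _ := add_le_add (Q.le_of_opNorm_le hQ _) (S.le_opNorm _)
    linarith
  · have h2 : u = S (pointwiseApply P u + f) := by
      rw [map_add]; exact h1
    have h3 := hS (pointwiseApply P u + f) t
    rw [← h2] at h3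
    refine h3.congr_deriv ?_
    simp [add_assoc]

end BoundedSolutions

/-! ### The singular point: logarithmic time -/

section NearZero

open Polynomial in
-- Cayley-Hamilton for A, with the characteristic polynomial translated by c.
theorem exists_shifted_annihilator {E : Type*} [NormedAddCommGroup E] [NormedSpace ℝ E]
    [FiniteDimensional ℝ E] (A : E →L[ℝ] E) (c : ℝ) :
    ∃ p : ℝ[X], p ≠ 0 ∧ aeval (A - c • 1) p = 0 ∧ ∀ z : ℂ, aeval z p = 0 →
      aeval (z + c) (LinearMap.charpoly (A : E →ₗ[ℝ] E)) = 0 := by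
  set q := LinearMap.charpoly (A : E →ₗ[ℝ] E)
  have hq : q.Monic := LinearMap.charpoly_monic _
  have hqA : aeval A q = 0 := by
    have h1 : ∀ r : ℝ[X], ((aeval A r : E →L[ℝ] E) : E →ₗ[ℝ] E) = aeval (A : E →ₗ[ℝ] E) r := by
      intro r
      exact hom_eval₂ r (algebraMap ℝ (E →L[ℝ] E))
        (ContinuousLinearMap.toLinearMapRingHom (R₁ := ℝ) (M₁ := E)) A
    ext v
    have h2 := DFunLike.congr_fun ((h1 q).trans (LinearMap.aeval_self_charpoly _)) v
    exact h2
  refine ⟨q.comp (X + C c), ?_, ?_, fun z hz => ?_⟩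
  · exact (hq.comp_X_add_C c).ne_zero
  · rw [aeval_comp]
    simpa [Algebra.algebraMap_eq_smul_one] using hqA
  · rw [aeval_comp] at hz
    simpa using hz

/-- A polynomial has finitely many roots, so their real parts stay away from 1. Requiring α < 1
keeps the B-term small after weighting by x^{-(1+α)}. -/
theorem exists_spectral_gap {q : Polynomial ℝ} (hq : q ≠ 0)
    (h : ∀ z : ℂ, Polynomial.aeval z q = 0 → z.re ≠ 1) :
    ∃ α : ℝ, 0 < α ∧ α < 1 ∧
      ∀ z : ℂ, Polynomial.aeval z q = 0 → 1 + α < z.re ∨ z.re < 1 := by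
  have hfin : (Complex.re '' {z : ℂ | Polynomial.aeval z q = 0}).Finite := by
    refine Set.Finite.image _ ((q.rootSet_finite ℂ).subset fun z hz => ?_)
    exact (Polynomial.mem_rootSet_of_ne hq).2 hz
  have h1 : (Complex.re '' {z : ℂ | Polynomial.aeval z q = 0})ᶜ ∈ 𝓝 (1 : ℝ) := by
    refine hfin.isClosed.isOpen_compl.mem_nhds ?_
    rintro ⟨z, hz, hz1⟩
    exact h z hz hz1
  obtain ⟨ε, hε, hball⟩ := Metric.mem_nhds_iff.1 h1
  refine ⟨min (ε / 2) (1 / 2), by positivity, by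
    have := min_le_right (ε / 2) (1 / 2 : ℝ); linarith, fun z hz => ?_⟩
  by_contra! hcon
  have := min_le_left (ε / 2) (1 / 2 : ℝ)
  refine hball (a := z.re) ?_ ⟨z, hz, rfl⟩
  rw [Metric.mem_ball, Real.dist_eq, abs_lt]
  constructor <;> linarith [hcon.1, hcon.2]

/-- Setting x = eᵗ makes A/x autonomous, the weight x^{-c} shifts A by c, and B and f gain a factor
eᵗ. -/
theorem hasDerivAt_exp_substitution {E : Type*} [NormedAddCommGroup E] [NormedSpace ℝ E]
    {A : E →L[ℝ] E} {B : ℝ → E →L[ℝ] E} {y f : ℝ → E} (c t : ℝ)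
    (h : HasDerivAt y (coeff A B (Real.exp t) (y (Real.exp t)) + f (Real.exp t)) (Real.exp t)) :
    HasDerivAt (fun t => Real.exp (-c * t) • y (Real.exp t))
      ((A - c • 1) (Real.exp (-c * t) • y (Real.exp t)) +
        ((Real.exp t * Real.exp (-c * t)) • B (Real.exp t) (y (Real.exp t)) +
          (Real.exp t * Real.exp (-c * t)) • f (Real.exp t))) t := by
  have hexp : HasDerivAt (fun s => Real.exp (-c * s)) (-c * Real.exp (-c * t)) t := by
    simpa [mul_comm] using ((hasDerivAt_id t).const_mul (-c)).exp
  refine (hexp.smul (h.scomp t (Real.hasDerivAt_exp t))).congr_deriv ?_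
  have : Real.exp t ≠ 0 := (Real.exp_pos t).ne'
  simp only [coeff, add_apply, smul_apply, sub_apply, one_apply_eq_self, map_smul, smul_add,
    smul_smul, Function.comp_apply]
  match_scalars <;> field_simp

variable {E : Type*} [NormedAddCommGroup E] [InnerProductSpace ℝ E] [FiniteDimensional ℝ E]
  {A : E →L[ℝ] E} {B : ℝ → E →L[ℝ] E}
  (hB : ContinuousOn B (Ici 0)) (hB_bdd : ∃ M, ∀ x, 0 ≤ x → ‖B x‖ ≤ M)
  (hA : ∀ z : ℂ, Polynomial.aeval z (LinearMap.charpoly (A : E →ₗ[ℝ] E)) = 0 → z.re ≠ 1)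
  {x₀ : ℝ} (hx₀ : 0 < x₀)
include hB hB_bdd hA hx₀

/-- The bound O(x) improves itself: weighted by x^{-(1+α)}, the solution grows at most like
exp(-αt), while A - (1 + α) has no eigenvalue with real part in [-α, 0] by the spectral gap. The
B-term is O(exp((1 - α)t)), so the weighted solution tends to zero. -/
theorem mem_spaceVPlus_iff {v : E} : v ∈ spaceVPlus A B x₀ ↔
    (fun x => evolution A B x₀ x v) =O[𝓝[>] 0] fun x : ℝ => x := by
  constructor
  · rintro ⟨α, hα, h⟩
    refine h.trans (IsBigO.of_bound 1 ?_)
    filter_upwards [Ioo_mem_nhdsGT (zero_lt_one' ℝ)] with x hx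
    rw [Real.norm_of_nonneg (Real.rpow_nonneg hx.1.le _), Real.norm_of_nonneg hx.1.le, one_mul]
    simpa using Real.rpow_le_rpow_of_exponent_ge hx.1 hx.2.le (show (1 : ℝ) ≤ 1 + α by linarith)
  · intro h
    obtain ⟨α, hα, hα1, hgap⟩ := exists_spectral_gap (LinearMap.charpoly_monic _).ne_zero hA
    obtain ⟨p, hp, hpN, hroots⟩ := exists_shifted_annihilator A (1 + α)
    obtain ⟨K, hK⟩ := h.bound
    obtain ⟨M, hM⟩ := hB_bdd
    have hKt : ∀ᶠ t in atBot,
        ‖evolution A B x₀ (Real.exp t) v‖ ≤ K * Real.exp t := by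
      filter_upwards [Real.tendsto_exp_atBot_nhdsGT.eventually hK] with t ht
      simpa using ht
    set z : ℝ → E := fun t => Real.exp (-(1 + α) * t) • evolution A B x₀ (Real.exp t) v
    have hz : Tendsto z atBot (𝓝 0) := by
      refine tendsto_zero_of_equation hp hpN hα.le (fun w hw => ?_)
        (Eventually.of_forall fun t => hasDerivAt_exp_substitution (1 + α) t
          (f := fun _ => (0 : E)) (by
            simpa using hasDerivAt_evolution_apply hB hx₀ (A := A) v (Real.exp_pos t)))
        ⟨K, ?_⟩ ?_
      · have := hgap _ (hroots w hw)
        simp only [Complex.add_re, Complex.one_re, Complex.ofReal_re, Complex.ofReal_add,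
          Complex.ofReal_one] at this
        rcases this with h | h
        · left; linarith
        · right; linarith
      · filter_upwards [hKt] with t ht
        rw [norm_smul, Real.norm_of_nonneg (Real.exp_pos _).le]
        calc _ ≤ Real.exp (-(1 + α) * t) * (K * Real.exp t) :=
              mul_le_mul_of_nonneg_left ht (Real.exp_pos _).le
          _ = K * (Real.exp (-(1 + α) * t) * Real.exp t) := by ring
          _ = _ := by rw [← Real.exp_add]; ring_nf
      · have hlim : Tendsto (fun t => M * K * Real.exp ((1 - α) * t)) atBot (𝓝 0) := by
          simpa using (tendsto_exp_mul_atBot (show 0 < 1 - α by linarith)).const_mul (M * K)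
        refine squeeze_zero_norm' ?_ hlim
        filter_upwards [hKt] with t ht
        have hM0 : 0 ≤ M := (norm_nonneg _).trans (hM 0 le_rfl)
        rw [smul_zero, add_zero, norm_smul,
          Real.norm_of_nonneg (mul_pos (Real.exp_pos _) (Real.exp_pos _)).le]
        calc _ ≤ Real.exp t * Real.exp (-(1 + α) * t) * (M * (K * Real.exp t)) := by
              refine mul_le_mul_of_nonneg_left ?_ (by positivity)
              exact (B _).le_of_opNorm_le_of_le (hM _ (Real.exp_pos t).le) ht
          _ = M * K * (Real.exp t * Real.exp (-(1 + α) * t) * Real.exp t) := by ring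
          _ = _ := by rw [← Real.exp_add, ← Real.exp_add]; ring_nf
    refine ⟨α, hα, IsBigO.of_bound 1 ?_⟩
    have h1 : ∀ᶠ t in atBot, ‖z t‖ < 1 := by
      simpa using hz.norm.eventually (gt_mem_nhds (show ‖(0 : E)‖ < 1 by simp))
    filter_upwards [Real.tendsto_log_nhdsGT_zero.eventually h1, self_mem_nhdsWithin] with x hx hx0
    have hx0 : 0 < x := hx0
    have h2 : x ^ (1 + α) = Real.exp ((1 + α) * Real.log x) := by
      rw [Real.rpow_def_of_pos hx0, mul_comm]
    simp only [z, norm_smul, Real.exp_log hx0, Real.norm_of_nonneg (Real.exp_pos _).le] at hx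
    rw [h2, Real.norm_of_nonneg (Real.exp_pos _).le, one_mul]
    have h3 : Real.exp ((1 + α) * Real.log x) * Real.exp (-(1 + α) * Real.log x) = 1 := by
      rw [← Real.exp_add, ← add_mul, add_neg_cancel, zero_mul, Real.exp_zero]
    calc _ = Real.exp ((1 + α) * Real.log x) *
          (Real.exp (-(1 + α) * Real.log x) * ‖evolution A B x₀ x v‖) := by
          rw [← mul_assoc, h3, one_mul]
      _ ≤ Real.exp ((1 + α) * Real.log x) * 1 :=
          mul_le_mul_of_nonneg_left hx.le (Real.exp_pos _).le
      _ = _ := mul_one _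

/-- Near zero the inhomogeneous system has a solution which is `O(x)`, with a constant proportional
to the supremum of the right-hand side. -/
theorem exists_variation_norm_le : ∃ δ > 0, ∃ K : ℝ, ∀ (f : ℝ → E) (m : ℝ),
    ContinuousOn f (Ioi 0) → (∀ x ∈ Ioc 0 δ, ‖f x‖ ≤ m) → ∃ c, ∀ x ∈ Ioo 0 δ,
      ‖evolution A B x₀ x (c + ∫ s in x₀..x, evolutionInv A B x₀ s (f s))‖ ≤ K * m * x := by
  have := FiniteDimensional.complete ℝ E
  obtain ⟨p, hp, hpN, hroots⟩ := exists_shifted_annihilator A 1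
  obtain ⟨ε, hε, K, hK⟩ := exists_bounded_solution hp hpN fun z hz => by
    have := hA _ (hroots z hz)
    simpa using this
  obtain ⟨M, hM⟩ := hB_bdd
  have hM0 : 0 ≤ M := (norm_nonneg _).trans (hM 0 le_rfl)
  -- For x ≤ δ the perturbation x‖B(x)‖ is at most ε. Freezing x at δ through τ extends the
  -- coefficients to all times t while keeping this bound.
  set δ := ε / (M + 1)
  have hδ : 0 < δ := by positivity
  set τ : ℝ → ℝ := fun t => Real.exp (min t (Real.log δ))
  have hτc : Continuous τ := by fun_prop
  have hτ : ∀ t, τ t ∈ Ioc 0 δ := fun t => ⟨Real.exp_pos _, by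
    simpa [Real.exp_log hδ] using Real.exp_le_exp.2 (min_le_right t (Real.log δ))⟩
  have hτlog : ∀ x ∈ Ioo 0 δ, τ (Real.log x) = x := fun x hx => by
    simp only [τ]
    rw [min_eq_left (Real.log_le_log hx.1 hx.2.le), Real.exp_log hx.1]
  let P : BoundedContinuousFunction ℝ (E →L[ℝ] E) :=
    BoundedContinuousFunction.ofNormedAddCommGroup (fun t => τ t • B (τ t))
      (hτc.smul (hB.comp_continuous hτc fun t => (hτ t).1.le)) ε (fun t => by
        rw [norm_smul, Real.norm_of_nonneg (hτ t).1.le]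
        calc τ t * ‖B (τ t)‖ ≤ δ * (M + 1) :=
              mul_le_mul (hτ t).2 ((hM _ (hτ t).1.le).trans (by linarith)) (norm_nonneg _) hδ.le
          _ = ε := by simp only [δ]; field_simp)
  have hP : ‖P‖ ≤ ε := BoundedContinuousFunction.norm_ofNormedAddCommGroup_le _ hε.le _
  refine ⟨δ, hδ, |K|, fun f m hf hfm => ?_⟩
  let F : BoundedContinuousFunction ℝ E :=
    BoundedContinuousFunction.ofNormedAddCommGroup (fun t => f (τ t))
      (hf.comp_continuous hτc fun t => (hτ t).1) m fun t => hfm _ (hτ t)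
  have hm : 0 ≤ m := (norm_nonneg _).trans (hfm δ ⟨hδ, le_rfl⟩)
  have hF : ‖F‖ ≤ m := BoundedContinuousFunction.norm_ofNormedAddCommGroup_le _ hm _
  obtain ⟨u, hu, hud⟩ := hK P hP F
  have hu' : ‖u‖ ≤ |K| * m := hu.trans
    (mul_le_mul (le_abs_self K) hF (norm_nonneg _) (abs_nonneg K))
  -- Undoing the substitution, x · u(log x) solves the original system where τ is unfrozen, that is
  -- on (0, δ).
  obtain ⟨c, hc⟩ := exists_variation hB hx₀ (A := A) hf isOpen_Ioo (isPreconnected_Ioo (a := 0)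
    (b := δ)) (fun x hx => hx.1) (y := fun x => x • u (Real.log x)) (fun x hx => by
      refine ((hasDerivAt_id x).smul ((hud (Real.log x)).scomp x
        (Real.hasDerivAt_log hx.1.ne'))).congr_deriv ?_
      have hx0 : x ≠ 0 := hx.1.ne'
      simp only [coeff, P, F, BoundedContinuousFunction.coe_ofNormedAddCommGroup, hτlog x hx,
        add_apply, smul_apply, sub_apply, one_apply_eq_self, map_smul, id,
        Function.comp_apply]
      match_scalars <;> field_simp
      ring)
  refine ⟨c, fun x hx => ?_⟩
  rw [← hc x hx, norm_smul, Real.norm_of_nonneg hx.1.le, mul_comm]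
  exact mul_le_mul_of_nonneg_right ((u.norm_coe_le_norm _).trans hu') hx.1.le

end NearZero

/-! ### Integrability at zero and the condition on c -/

section NearZeroIntegrability

variable {E : Type*} [NormedAddCommGroup E] [InnerProductSpace ℝ E] [FiniteDimensional ℝ E]
  {A : E →L[ℝ] E} {B : ℝ → E →L[ℝ] E}
  (hB : ContinuousOn B (Ici 0)) (hB_bdd : ∃ M, ∀ x, 0 ≤ x → ‖B x‖ ≤ M)
  (hA : ∀ z : ℂ, Polynomial.aeval z (LinearMap.charpoly (A : E →ₗ[ℝ] E)) = 0 → z.re ≠ 1)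
  {x₀ : ℝ} (hx₀ : 0 < x₀)
include hB hB_bdd hA hx₀

/-- A functional vanishing on `V₊` has an integrable composition with `Y⁻¹(s)` near zero: test the
existence of `O(x)` solutions against right-hand sides along the dual vectors. -/
theorem integrableOn_norm_functional {ℓ : E →L[ℝ] ℝ} (hℓ : ∀ v ∈ spaceVPlus A B x₀, ℓ v = 0) :
    ∃ δ > 0, IntegrableOn (fun s => ‖ℓ ∘L evolutionInv A B x₀ s‖) (Ioc 0 δ) := by
  have := FiniteDimensional.complete ℝ E
  by_cases hℓ0 : ℓ = 0
  · exact ⟨1, one_pos, by simp [hℓ0]⟩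
  obtain ⟨δ, hδ, K, hK⟩ := exists_variation_norm_le hB hB_bdd hA hx₀
  set ψ : ℝ → E →L[ℝ] ℝ := fun s => ℓ ∘L evolutionInv A B x₀ s with hψdef
  have hψc : ContinuousOn ψ (Ioi 0) :=
    continuousOn_const.clm_comp (continuousOn_evolutionInv hB hx₀)
  have hψ0 : ∀ s, 0 < s → ψ s ≠ 0 := by
    intro s hs h
    refine hℓ0 (ContinuousLinearMap.ext fun v => ?_)
    have := DFunLike.congr_fun h (evolution A B x₀ s v)
    simpa [hψdef, evolutionInv_apply hB hx₀ hs] using this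
  -- The Riesz vector of ψ(s) = ℓY⁻¹(s): in the direction of φ(s) the functional attains its norm.
  set φ : ℝ → E := fun s => (InnerProductSpace.toDual ℝ E).symm (ψ s) with hφdef
  have hφn : ∀ s, ‖φ s‖ = ‖ψ s‖ := fun s => LinearIsometryEquiv.norm_map _ _
  have hφψ : ∀ s, ψ s (φ s) = ‖ψ s‖ ^ 2 := fun s => by
    rw [← hφn, ← real_inner_self_eq_norm_sq, hφdef, InnerProductSpace.toDual_symm_apply]
  have hφc : ContinuousOn φ (Ioi 0) :=
    (InnerProductSpace.toDual ℝ E).symm.continuous.comp_continuousOn hψc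
  set x₁ := δ / 2 with hx₁def
  have hx₁ : 0 < x₁ := by positivity
  have hx₁δ : x₁ < δ := half_lt_self hδ
  -- The bound does not depend on ρ, which yields integrability down to zero.
  have hbound : ∀ ρ, 0 < ρ → ρ ≤ x₁ → (∫ s in ρ..x₁, ‖ψ s‖) ≤ ‖ψ x₁‖ * (K * 1 * x₁) := by
    intro ρ hρ hρx
    -- A continuous cutoff, 0 up to ρ/2 and 1 from ρ on; the right-hand side is then continuous,
    -- bounded by 1, and zero near the singularity.
    set χ : ℝ → ℝ := fun s => max 0 (min 1 (2 * s / ρ - 1)) with hχdef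
    have hχc : Continuous χ := by fun_prop
    have hχ0 : ∀ s, 0 ≤ χ s := fun s => le_max_left _ _
    have hχ1 : ∀ s, χ s ≤ 1 := fun s => max_le zero_le_one (min_le_left _ _)
    have hχl : ∀ s, s ≤ ρ / 2 → χ s = 0 := fun s hs => by
      have : 2 * s / ρ - 1 ≤ 0 := by
        rw [sub_nonpos, div_le_one hρ]; linarith
      exact max_eq_left ((min_le_right _ _).trans this)
    have hχr : ∀ s, ρ ≤ s → χ s = 1 := fun s hs => by
      have : 1 ≤ 2 * s / ρ - 1 := by
        rw [le_sub_iff_add_le, le_div_iff₀ hρ]; linarith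
      simp only [hχdef]
      rw [min_eq_left this, max_eq_right zero_le_one]
    set f : ℝ → E := fun s => χ s • ‖φ s‖⁻¹ • φ s with hfdef
    have hφ0 : ∀ s, 0 < s → ‖φ s‖ ≠ 0 := fun s hs => by
      rw [hφn]; exact norm_ne_zero_iff.2 (hψ0 s hs)
    have hfc : ContinuousOn f (Ioi 0) :=
      hχc.continuousOn.smul ((hφc.norm.inv₀ fun s hs => hφ0 s hs).smul hφc)
    have hf1 : ∀ s ∈ Ioc 0 δ, ‖f s‖ ≤ 1 := fun s hs => by
      rw [hfdef]
      simp only [norm_smul, norm_inv, norm_norm]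
      rw [inv_mul_cancel₀ (hφ0 s hs.1), mul_one, Real.norm_of_nonneg (hχ0 s)]
      exact hχ1 s
    have hψf : ∀ s, 0 < s → ψ s (f s) = χ s * ‖ψ s‖ := fun s hs => by
      have h1 : ‖ψ s‖ ≠ 0 := norm_ne_zero_iff.2 (hψ0 s hs)
      simp only [hfdef, map_smul, hφψ, smul_eq_mul, hφn]
      field_simp
    obtain ⟨c, hc⟩ := hK f 1 hfc hf1
    set F : ℝ → E := fun x => ∫ s in x₀..x, evolutionInv A B x₀ s (f s) with hFdef
    have hi : ∀ x y, 0 < x → 0 < y → IntervalIntegrable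
        (fun s => evolutionInv A B x₀ s (f s)) volume x y := fun x y hx hy =>
      intervalIntegrable_Ioi ((continuousOn_evolutionInv hB hx₀).clm_apply hfc) hx hy
    have hFsub : ∀ x y, 0 < x → 0 < y →
        F y - F x = ∫ s in x..y, evolutionInv A B x₀ s (f s) := fun x y hx hy =>
      intervalIntegral.integral_interval_sub_left (hi _ _ hx₀ hy) (hi _ _ hx₀ hx)
    have hρ2 : 0 < ρ / 2 := half_pos hρ
    -- Below ρ/2 the O(x) solution is homogeneous, so its initial value lies in V₊, where ℓ
    -- vanishes. Applying ℓ at x₁ therefore leaves only the integral of χ‖ψ‖.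
    have hmem : c + F (ρ / 2) ∈ spaceVPlus A B x₀ := by
      rw [mem_spaceVPlus_iff hB hB_bdd hA hx₀]
      refine IsBigO.of_bound (K * 1) ?_
      filter_upwards [Ioo_mem_nhdsGT hρ2] with x hx
      have h1 : F x = F (ρ / 2) := by
        rw [← sub_eq_zero, hFsub _ _ hρ2 hx.1]
        refine intervalIntegral.integral_zero_ae (ae_of_all _ fun s hs => ?_)
        rw [uIoc_of_ge hx.2.le] at hs
        simp [hfdef, hχl s hs.2]
      rw [← h1, Real.norm_of_nonneg hx.1.le]
      exact hc x ⟨hx.1, hx.2.trans (by linarith)⟩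
    have h1 : ℓ (c + F x₁) = ∫ s in (ρ / 2)..x₁, χ s * ‖ψ s‖ := by
      have h2 : c + F x₁ = (c + F (ρ / 2)) + (F x₁ - F (ρ / 2)) := by abel
      rw [h2, map_add, hℓ _ hmem, zero_add, hFsub _ _ hρ2 hx₁,
        ← ℓ.intervalIntegral_comp_comm (hi _ _ hρ2 hx₁)]
      refine intervalIntegral.integral_congr fun s hs => ?_
      rw [uIcc_of_le (by linarith)] at hs
      exact hψf s (hρ2.trans_le hs.1)
    have hci : ∀ x y, 0 < x → 0 < y → IntervalIntegrable (fun s => χ s * ‖ψ s‖) volume x y :=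
      fun x y hx hy => intervalIntegrable_Ioi (hχc.continuousOn.mul hψc.norm) hx hy
    have h2 : (∫ s in ρ..x₁, ‖ψ s‖) ≤ ∫ s in (ρ / 2)..x₁, χ s * ‖ψ s‖ := by
      rw [← intervalIntegral.integral_add_adjacent_intervals (hci _ _ hρ2 hρ) (hci _ _ hρ hx₁)]
      have h3 : 0 ≤ ∫ s in (ρ / 2)..ρ, χ s * ‖ψ s‖ :=
        intervalIntegral.integral_nonneg (by linarith) fun s _ =>
          mul_nonneg (hχ0 s) (norm_nonneg _)
      have h4 : (∫ s in ρ..x₁, ‖ψ s‖) = ∫ s in ρ..x₁, χ s * ‖ψ s‖ := by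
        refine intervalIntegral.integral_congr fun s hs => ?_
        rw [uIcc_of_le hρx] at hs
        simp [hχr s hs.1]
      rw [h4]
      linarith
    calc _ ≤ ℓ (c + F x₁) := h2.trans_eq h1.symm
      _ = ψ x₁ (evolution A B x₀ x₁ (c + F x₁)) := by
        simp [hψdef, evolutionInv_apply hB hx₀ hx₁]
      _ ≤ ‖ψ x₁ (evolution A B x₀ x₁ (c + F x₁))‖ := le_abs_self _
      _ ≤ ‖ψ x₁‖ * (K * 1 * x₁) :=
        (ψ x₁).le_opNorm_of_le (hc x₁ ⟨hx₁, hx₁δ⟩)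
  refine ⟨x₁, hx₁, integrableOn_Ioc_of_intervalIntegral_norm_bounded_left (l := atTop)
    (a := fun n : ℕ => x₁ * (1 / 2) ^ n) (I := ‖ψ x₁‖ * (K * 1 * x₁)) (fun n => ?_) ?_
    (Eventually.of_forall fun n => ?_)⟩
  · have hρ : 0 < x₁ * (1 / 2 : ℝ) ^ n := by positivity
    exact (intervalIntegrable_Ioi hψc.norm hρ hx₁).1
  · simpa using (tendsto_pow_atTop_nhds_zero_of_lt_one (r := (1 / 2 : ℝ)) (by norm_num)
      (by norm_num)).const_mul x₁
  · have hρ : 0 < x₁ * (1 / 2 : ℝ) ^ n := by positivity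
    have hρx : x₁ * (1 / 2 : ℝ) ^ n ≤ x₁ :=
      mul_le_of_le_one_right hx₁.le (pow_le_one₀ (by norm_num) (by norm_num))
    simp only [norm_norm]
    rw [← intervalIntegral.integral_of_le hρx]
    exact hbound _ hρ hρx

/-- The coordinates of Q in an orthonormal basis are functionals vanishing on V₊; away from zero
continuity suffices. -/
theorem integrableOn_norm_operator {Q : E →L[ℝ] E} (hQ : ∀ v ∈ spaceVPlus A B x₀, Q v = 0)
    (b : ℝ) : IntegrableOn (fun s => ‖Q * evolutionInv A B x₀ s‖) (Ioc 0 b) := by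
  have hcont : ContinuousOn (fun s => Q * evolutionInv A B x₀ s) (Ioi 0) :=
    continuousOn_const.mul (continuousOn_evolutionInv hB hx₀)
  have hnear : ∃ δ > 0, IntegrableOn (fun s => ‖Q * evolutionInv A B x₀ s‖) (Ioc 0 δ) := by
    set e := stdOrthonormalBasis ℝ E
    have h : ∀ i, ∃ δ > 0, IntegrableOn
        (fun s => ‖(innerSL ℝ (e i) ∘L Q) ∘L evolutionInv A B x₀ s‖) (Ioc 0 δ) := fun i =>
      integrableOn_norm_functional hB hB_bdd hA hx₀ fun v hv => by simp [hQ v hv]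
    choose δ hδ hint using h
    obtain ⟨r, hr, hrδ⟩ : ∃ r > 0, ∀ i, r ≤ δ i := by
      have : ∀ᶠ r in 𝓝[>] (0 : ℝ), ∀ i, r ≤ δ i := eventually_all.2 fun i => by
        filter_upwards [Ioo_mem_nhdsGT (hδ i)] with r hr using hr.2.le
      obtain ⟨r, h1, h2⟩ := (this.and self_mem_nhdsWithin).exists
      exact ⟨r, h2, h1⟩
    refine ⟨r, hr, Integrable.mono' (integrable_finsetSum Finset.univ fun i _ =>
      (hint i).mono_set (Ioc_subset_Ioc_right (hrδ i)))
      ((hcont.norm.mono Ioc_subset_Ioi_self).aestronglyMeasurable measurableSet_Ioc)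
      (ae_of_all _ fun s => ?_)⟩
    rw [norm_norm]
    refine ContinuousLinearMap.opNorm_le_bound _
      (Finset.sum_nonneg fun i _ => norm_nonneg _) fun v => ?_
    set w := (Q * evolutionInv A B x₀ s) v
    calc ‖w‖ = ‖∑ i, inner ℝ (e i) w • e i‖ := by rw [e.sum_repr' w]
      _ ≤ ∑ i, ‖inner ℝ (e i) w • e i‖ := norm_sum_le _ _
      _ ≤ ∑ i, ‖(innerSL ℝ (e i) ∘L Q) ∘L evolutionInv A B x₀ s‖ * ‖v‖ := by
        refine Finset.sum_le_sum fun i _ => ?_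
        rw [norm_smul, e.norm_eq_one, mul_one]
        exact ((innerSL ℝ (e i) ∘L Q) ∘L evolutionInv A B x₀ s).le_opNorm v
      _ = _ := by rw [Finset.sum_mul]
  obtain ⟨δ, hδ, hint⟩ := hnear
  refine (hint.union (intervalIntegrable_Ioi hcont.norm hδ
    (lt_max_of_lt_right hδ : 0 < max b δ)).1).mono_set ?_
  rw [Ioc_union_Ioc_eq_Ioc hδ.le (le_max_right b δ)]
  exact Ioc_subset_Ioc_right (le_max_left b δ)

theorem integrableOn_Ioc_projection {Q : E →L[ℝ] E} (hQ : ∀ v ∈ spaceVPlus A B x₀, Q v = 0)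
    {f : ℝ → E} (hf : ContinuousOn f (Ici 0)) (b : ℝ) :
    IntegrableOn (fun s => Q (evolutionInv A B x₀ s (f s))) (Ioc 0 b) := by
  obtain ⟨m, hm⟩ := (isCompact_Icc (a := 0) (b := b)).exists_bound_of_continuousOn
    (hf.mono fun x hx => hx.1)
  refine ((integrableOn_norm_operator hB hB_bdd hA hx₀ hQ b).mul_const m).mono' ?_ ?_
  · refine ContinuousOn.aestronglyMeasurable ?_ measurableSet_Ioc
    exact (Q.continuous.comp_continuousOn ((continuousOn_evolutionInv hB hx₀).clm_apply
      (hf.mono Ioi_subset_Ici_self))).mono Ioc_subset_Ioi_self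
  · refine (ae_restrict_mem measurableSet_Ioc).mono fun s hs => ?_
    exact (Q * evolutionInv A B x₀ s).le_opNorm_of_le (hm s ⟨hs.1.le, hs.2⟩)

/-- The initial value of an `O(x)` solution of the inhomogeneous system, modulo `V₊`. -/
theorem projection_eq_of_isBigO {Q : E →L[ℝ] E} (hQ : ∀ v ∈ spaceVPlus A B x₀, Q v = 0)
    {f : ℝ → E} (hf : ContinuousOn f (Ici 0)) {c : E}
    (h : (fun x => evolution A B x₀ x (c + ∫ s in x₀..x, evolutionInv A B x₀ s (f s)))
      =O[𝓝[>] 0] fun x : ℝ => x) :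
    Q c = ∫ s in Ioc 0 x₀, Q (evolutionInv A B x₀ s (f s)) := by
  have := FiniteDimensional.complete ℝ E
  have hf' : ContinuousOn f (Ioi 0) := hf.mono Ioi_subset_Ici_self
  set F : ℝ → E := fun x => ∫ s in x₀..x, evolutionInv A B x₀ s (f s) with hFdef
  set I := ∫ s in Ioc 0 x₀, Q (evolutionInv A B x₀ s (f s)) with hIdef
  have hint := integrableOn_Ioc_projection hB hB_bdd hA hx₀ hQ hf x₀
  -- Q(c + F(x)) equals QY⁻¹(x)y(x) with y = O(x). Were the limit nonzero, ‖QY⁻¹(x)‖ would be at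
  -- least a multiple of 1/x, contradicting integrability.
  have hlim : Tendsto (fun x => Q (c + F x)) (𝓝[>] 0) (𝓝 (Q c - I)) := by
    have h1 : Tendsto (fun x => ∫ s in x..x₀, Q (evolutionInv A B x₀ s (f s))) (𝓝[>] 0) (𝓝 I) := by
      rw [hIdef, ← intervalIntegral.integral_of_le hx₀.le]
      have h2 : ContinuousOn (fun x => ∫ s in x..x₀, Q (evolutionInv A B x₀ s (f s)))
          (uIcc 0 x₀) :=
        intervalIntegral.continuousOn_primitive_interval_left (by
          rw [uIcc_of_le hx₀.le]; exact (integrableOn_Icc_iff_integrableOn_Ioc).2 hint)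
      refine ((h2 0 left_mem_uIcc).mono_left ?_)
      rw [uIcc_of_le hx₀.le, nhdsWithin_Icc_eq_nhdsGE hx₀]
      exact nhdsWithin_mono _ Ioi_subset_Ici_self
    refine (h1.const_sub (Q c)).congr' ?_
    filter_upwards [self_mem_nhdsWithin] with x hx
    have hx : 0 < x := hx
    rw [map_add, hFdef, ← Q.intervalIntegral_comp_comm (intervalIntegrable_Ioi
      ((continuousOn_evolutionInv hB hx₀).clm_apply hf') hx₀ hx),
      intervalIntegral.integral_symm, sub_eq_add_neg, neg_neg]
  by_contra hne
  have hpos : 0 < ‖Q c - I‖ := norm_pos_iff.2 (sub_ne_zero.2 hne)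
  obtain ⟨K, hK0, hK⟩ := h.exists_pos
  have hev : ∀ᶠ x in 𝓝[>] (0 : ℝ),
      x⁻¹ ≤ (2 * K / ‖Q c - I‖) * ‖Q * evolutionInv A B x₀ x‖ := by
    filter_upwards [hK.bound, hlim.norm.eventually (lt_mem_nhds (half_lt_self hpos)),
      self_mem_nhdsWithin] with x h1 h2 hx
    have hx : 0 < x := hx
    have h3 : ‖Q (c + F x)‖ ≤ ‖Q * evolutionInv A B x₀ x‖ * (K * x) := by
      have h4 := (Q * evolutionInv A B x₀ x).le_opNorm_of_le h1
      rw [Real.norm_of_nonneg hx.le] at h4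
      refine le_trans (le_of_eq ?_) h4
      rw [mul_apply_eq_comp, evolutionInv_apply hB hx₀ hx]
    rw [inv_le_iff_one_le_mul₀ hx, div_mul_eq_mul_div, div_mul_eq_mul_div, le_div_iff₀ hpos]
    linarith
  obtain ⟨δ, hδ, hδ'⟩ := mem_nhdsGT_iff_exists_Ioc_subset.1 hev
  have hbad : IntegrableOn (fun x : ℝ => x⁻¹) (Ioc 0 δ) := by
    refine ((integrableOn_norm_operator hB hB_bdd hA hx₀ hQ δ).const_mul
      (2 * K / ‖Q c - I‖)).mono' measurable_inv.aestronglyMeasurable ?_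
    refine (ae_restrict_mem measurableSet_Ioc).mono fun x hx => ?_
    rw [Real.norm_of_nonneg (inv_nonneg.2 hx.1.le)]
    exact hδ' hx
  have hδ0 : (0 : ℝ) < δ := hδ
  have := intervalIntegrable_inv_iff.1
    ((intervalIntegrable_iff_integrableOn_Ioc_of_le hδ0.le).2 hbad)
  rcases this with h | h
  · exact hδ0.ne h
  · exact h left_mem_uIcc

/-- Some O(x) solution exists and its constant c₁ satisfies the same equation, so c - c₁ lies in ker
Q = V₊ and adds a homogeneous O(x) solution. -/
theorem isBigO_of_projection_eq {Q : E →L[ℝ] E} (hQ : ∀ v, v ∈ spaceVPlus A B x₀ ↔ Q v = 0)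
    {f : ℝ → E} (hf : ContinuousOn f (Ici 0)) {c : E}
    (h : Q c = ∫ s in Ioc 0 x₀, Q (evolutionInv A B x₀ s (f s))) :
    (fun x => evolution A B x₀ x (c + ∫ s in x₀..x, evolutionInv A B x₀ s (f s)))
      =O[𝓝[>] 0] fun x : ℝ => x := by
  obtain ⟨δ, hδ, K, hK⟩ := exists_variation_norm_le hB hB_bdd hA hx₀
  obtain ⟨m, hm⟩ := (isCompact_Icc (a := 0) (b := δ)).exists_bound_of_continuousOn
    (hf.mono fun x hx => hx.1)
  obtain ⟨c₁, hc₁⟩ := hK f m (hf.mono Ioi_subset_Ici_self) fun x hx => hm x ⟨hx.1.le, hx.2⟩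
  have h1 : (fun x => evolution A B x₀ x (c₁ + ∫ s in x₀..x, evolutionInv A B x₀ s (f s)))
      =O[𝓝[>] 0] fun x : ℝ => x := by
    refine IsBigO.of_bound (K * m) ?_
    filter_upwards [Ioo_mem_nhdsGT hδ] with x hx
    rw [Real.norm_of_nonneg hx.1.le]
    exact hc₁ x hx
  have h2 := projection_eq_of_isBigO hB hB_bdd hA hx₀ (fun v hv => (hQ v).1 hv) hf h1
  have h3 : c - c₁ ∈ spaceVPlus A B x₀ := by
    rw [hQ, map_sub, h, h2, sub_self]
  rw [mem_spaceVPlus_iff hB hB_bdd hA hx₀] at h3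
  refine (h3.add h1).congr_left fun x => ?_
  rw [← map_add]
  congr 1
  abel

end NearZeroIntegrability

/-! ### C¹ regularity at zero -/

section Regularity

theorem isBigO_of_contDiffOn {E : Type*} [NormedAddCommGroup E] [NormedSpace ℝ E] {y : ℝ → E}
    (hy : ContDiffOn ℝ 1 y (Ici 0)) (h0 : Tendsto y (𝓝[>] 0) (𝓝 0)) :
    y 0 = 0 ∧ y =O[𝓝[>] 0] fun x : ℝ => x := by
  have hle : 𝓝[>] (0 : ℝ) ≤ 𝓝[≥] 0 := nhdsWithin_mono _ Ioi_subset_Ici_self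
  have hy0 : y 0 = 0 :=
    tendsto_nhds_unique ((hy.continuousOn 0 self_mem_Ici).mono_left hle) h0
  refine ⟨hy0, ?_⟩
  have hd := (hy.differentiableOn one_ne_zero 0 self_mem_Ici).isBigO_sub
  simpa [hy0] using hd.mono hle

variable {E : Type*} [NormedAddCommGroup E] [NormedSpace ℝ E] [FiniteDimensional ℝ E]
  {A : E →L[ℝ] E} {B : ℝ → E →L[ℝ] E}

/-- Supplies the slope c at zero: passing to the limit in y' = Ay/x + By + g forces c = Ac + g(0).
-/
theorem surjective_sub_one_of_charpoly
    (hA : ∀ z : ℂ, Polynomial.aeval z (LinearMap.charpoly (A : E →ₗ[ℝ] E)) = 0 → z.re ≠ 1) :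
    Function.Surjective (A - (1 : ℝ) • 1 : E →L[ℝ] E) := by
  refine LinearMap.surjective_of_injective
    (f := ((A - (1 : ℝ) • 1 : E →L[ℝ] E) : E →ₗ[ℝ] E)) ?_
  rw [← LinearMap.ker_eq_bot, LinearMap.ker_eq_bot']
  intro v hv
  by_contra hv0
  have hAv : (A : E →ₗ[ℝ] E) v = (1 : ℝ) • v := by
    simpa [sub_eq_zero] using hv
  have := (Module.End.hasEigenvalue_iff_isRoot_charpoly (A : E →ₗ[ℝ] E) 1).1
    (Module.End.hasEigenvalue_of_hasEigenvector
      ⟨Module.End.mem_eigenspace_iff.2 hAv, hv0⟩)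
  refine hA 1 ?_ Complex.one_re
  have h1 := Polynomial.aeval_algebraMap_apply_eq_algebraMap_eval (A := ℂ) (1 : ℝ)
    (LinearMap.charpoly (A : E →ₗ[ℝ] E))
  rw [this.eq_zero, map_one] at h1
  simpa using h1

/-- A solution which is `O(x)` at zero is continuously differentiable up to zero. -/
theorem contDiffOn_of_isBigO (hB_bdd : ∃ M, ∀ x, 0 ≤ x → ‖B x‖ ≤ M)
    (hB : ContinuousOn B (Ici 0))
    (hA : ∀ z : ℂ, Polynomial.aeval z (LinearMap.charpoly (A : E →ₗ[ℝ] E)) = 0 → z.re ≠ 1)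
    {g y : ℝ → E} (hg : ContinuousOn g (Ici 0))
    (hy : ∀ x, 0 < x → HasDerivAt y (coeff A B x (y x) + g x) x) (hy0 : y 0 = 0)
    (h : y =O[𝓝[>] 0] fun x : ℝ => x) : ContDiffOn ℝ 1 y (Ici 0) := by
  obtain ⟨p, hp, hpN, hroots⟩ := exists_shifted_annihilator A 1
  obtain ⟨c, hc⟩ := surjective_sub_one_of_charpoly hA (-g 0)
  obtain ⟨M, hM⟩ := hB_bdd
  obtain ⟨K, hK⟩ := h.bound
  have hylim : Tendsto y (𝓝[>] 0) (𝓝 0) :=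
    h.trans_tendsto (tendsto_id.mono_left nhdsWithin_le_nhds)
  have hBy : Tendsto (fun x => B x (y x)) (𝓝[>] 0) (𝓝 0) := by
    have h1 : Tendsto (fun x => M * ‖y x‖) (𝓝[>] 0) (𝓝 0) := by
      simpa using hylim.norm.const_mul M
    refine squeeze_zero_norm' ?_ h1
    filter_upwards [self_mem_nhdsWithin] with x hx
    exact (B x).le_of_opNorm_le (hM x (le_of_lt hx)) _
  have hglim : Tendsto g (𝓝[>] 0) (𝓝 (g 0)) :=
    (hg 0 self_mem_Ici).mono_left (nhdsWithin_mono _ Ioi_subset_Ici_self)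
  -- The deviation y/x - c is bounded and solves z' = (A - 1)z plus a forcing tending to zero, so it
  -- tends to zero.
  set z : ℝ → E := fun t => Real.exp (-1 * t) • y (Real.exp t) - c with hz
  have hzlim : Tendsto z atBot (𝓝 0) := by
    refine tendsto_zero_of_equation (β := 0) (f := fun t => B (Real.exp t) (y (Real.exp t)) +
      (g (Real.exp t) - g 0)) hp hpN le_rfl (fun w hw => ?_)
      (Eventually.of_forall fun t => ?_) ⟨K + ‖c‖, ?_⟩ ?_
    · have := hA _ (hroots w hw)
      simp only [Complex.add_re, Complex.ofReal_re, ne_eq, add_eq_right] at this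
      rw [neg_zero]
      exact (lt_or_gt_of_ne this).symm
    · refine ((hasDerivAt_exp_substitution 1 t (hy _ (Real.exp_pos t))).sub_const c).congr_deriv ?_
      have h1 : Real.exp t * Real.exp (-1 * t) = 1 := by rw [← Real.exp_add]; simp
      rw [h1, hz, map_sub, hc]
      module
    · filter_upwards [Real.tendsto_exp_atBot_nhdsGT.eventually hK] with t ht
      rw [Real.norm_of_nonneg (Real.exp_pos t).le] at ht
      have h1 : Real.exp (-1 * t) * Real.exp t = 1 := by rw [← Real.exp_add]; simp
      calc ‖z t‖ ≤ ‖Real.exp (-1 * t) • y (Real.exp t)‖ + ‖c‖ := norm_sub_le _ _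
        _ ≤ Real.exp (-1 * t) * (K * Real.exp t) + ‖c‖ := by
          rw [norm_smul, Real.norm_of_nonneg (Real.exp_pos _).le]
          gcongr
        _ = (Real.exp (-1 * t) * Real.exp t) * K + ‖c‖ := by ring
        _ = _ := by rw [h1]; simp
    · have h1 := hBy.add (hglim.sub_const (g 0))
      rw [sub_self, add_zero] at h1
      exact h1.comp Real.tendsto_exp_atBot_nhdsGT
  have hquot : Tendsto (fun x => x⁻¹ • y x) (𝓝[>] 0) (𝓝 c) := by
    have h1 := (hzlim.comp Real.tendsto_log_nhdsGT_zero).add_const c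
    rw [zero_add] at h1
    refine h1.congr' ?_
    filter_upwards [self_mem_nhdsWithin] with x hx
    have hx : 0 < x := hx
    simp [hz, Real.exp_neg, Real.exp_log hx]
  -- The equation itself turns y/x → c into y' → Ac + g(0) = c, and convergence of y' gives
  -- differentiability at the endpoint.
  have hderiv : Tendsto (fun x => deriv y x) (𝓝[>] 0) (𝓝 c) := by
    have h1 := (((A.continuous.tendsto c).comp hquot).add hBy).add hglim
    have h2 : A c + 0 + g 0 = c := by
      have : A c - c = -g 0 := by simpa using hc
      rw [add_zero, ← sub_eq_zero]
      calc A c + g 0 - c = (A c - c) + g 0 := by abel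
        _ = 0 := by rw [this]; simp
    rw [h2] at h1
    refine h1.congr' ?_
    filter_upwards [self_mem_nhdsWithin] with x hx
    rw [(hy x hx).deriv]
    simp [coeff]
  have hcw : ContinuousWithinAt y (Ioi 0) 0 := by
    rw [ContinuousWithinAt, hy0]; exact hylim
  have hd0 : HasDerivWithinAt y c (Ici 0) 0 :=
    hasDerivWithinAt_Ici_of_tendsto_deriv
      (fun x hx => (hy x hx).differentiableAt.differentiableWithinAt) hcw self_mem_nhdsWithin hderiv
  have hdw : ∀ x, 0 < x → derivWithin y (Ici 0) x = deriv y x := fun x hx =>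
    derivWithin_of_mem_nhds (Ici_mem_nhds hx)
  rw [contDiffOn_one_iff_derivWithin (uniqueDiffOn_Ici 0)]
  constructor
  · intro x hx
    rcases (mem_Ici.1 hx).eq_or_lt with rfl | hx
    · exact hd0.differentiableWithinAt
    · exact (hy x hx).differentiableAt.differentiableWithinAt
  · intro x hx
    rcases (mem_Ici.1 hx).eq_or_lt with rfl | hx
    · rw [← continuousWithinAt_sdiff_self, Ici_sdiff_left, ContinuousWithinAt,
        hd0.derivWithin (uniqueDiffOn_Ici 0 0 self_mem_Ici)]
      refine hderiv.congr' ?_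
      filter_upwards [self_mem_nhdsWithin] with x hx
      exact (hdw x hx).symm
    · have h1 : ContinuousOn (fun x => coeff A B x (y x) + g x) (Ioi 0) :=
        ((continuousOn_coeff A hB).clm_apply fun x hx =>
          (hy x hx).continuousAt.continuousWithinAt).add (hg.mono Ioi_subset_Ici_self)
      refine ((h1.continuousAt (Ioi_mem_nhds hx)).congr ?_).continuousWithinAt
      filter_upwards [Ioi_mem_nhds hx] with s hs
      rw [hdw s hs, (hy s hs).deriv]

end Regularity

/-! ### Exponential dichotomy and the condition at infinity -/

section Infinity

variable {E : Type*} [NormedAddCommGroup E] [NormedSpace ℝ E]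

/-- Exponential dichotomy on `[a, ∞)` with projector `P`, for the evolution operator normalized at
an arbitrary point `x₀`. -/
structure DichotomyWith (A : E →L[ℝ] E) (B : ℝ → E →L[ℝ] E) (x₀ a : ℝ) (P : E →L[ℝ] E)
    (K γ : ℝ) : Prop where
  pos : 0 < a
  K_pos : 0 < K
  γ_pos : 0 < γ
  idem : ∀ v, P (P v) = P v
  stable : ∀ s x, a ≤ s → s ≤ x → ‖evolution A B x₀ x * P * evolutionInv A B x₀ s‖ ≤
    K * Real.exp (-γ * (x - s))
  unstable : ∀ s x, a ≤ x → x ≤ s → ‖evolution A B x₀ x * (1 - P) * evolutionInv A B x₀ s‖ ≤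
    K * Real.exp (-γ * (s - x))

variable [FiniteDimensional ℝ E] {A : E →L[ℝ] E} {B : ℝ → E →L[ℝ] E}
  (hB : ContinuousOn B (Ici 0)) {x₀ : ℝ} (hx₀ : 0 < x₀)
include hB hx₀

theorem exists_dichotomyWith {a : ℝ} (ha : 0 < a) (h : IsExpDichotomic A B a) :
    ∃ P K γ, DichotomyWith A B x₀ a P K γ := by
  obtain ⟨P, hP, K, γ, hK, hγ, h1, h2⟩ := h
  have hconj : ∀ (R : E →L[ℝ] E) {x s : ℝ}, 0 < x → 0 < s →
      evolution A B x₀ x * (evolutionInv A B x₀ a * R * evolution A B x₀ a) *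
        evolutionInv A B x₀ s = evolution A B a x * R * evolutionInv A B a s := by
    intro R x s hx hs
    rw [evolution_change_base hB hx₀ ha hx, evolutionInv_change_base hB hx₀ ha hs]
    simp only [mul_assoc]
  refine ⟨evolutionInv A B x₀ a * P * evolution A B x₀ a, K, γ, ha, hK, hγ, ?_, ?_, ?_⟩
  · intro v
    have h3 : ∀ w, P (P w) = P w := fun w => DFunLike.congr_fun hP w
    simp only [mul_apply_eq_comp, evolution_inv_apply hB hx₀ ha, h3]
  · intro s x hs hx
    rw [hconj P (ha.trans_le (hs.trans hx)) (ha.trans_le hs)]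
    exact h1 s x hs hx
  · intro s x hx hs
    have h3 : 1 - evolutionInv A B x₀ a * P * evolution A B x₀ a =
        evolutionInv A B x₀ a * (1 - P) * evolution A B x₀ a := by
      rw [mul_sub, mul_one, sub_mul, evolutionInv_mul hB hx₀ ha]
    rw [h3, hconj (1 - P) (ha.trans_le hx) (ha.trans_le (hx.trans hs))]
    exact h2 s x hx hs

variable {a : ℝ} {P : E →L[ℝ] E} {K γ : ℝ} (hD : DichotomyWith A B x₀ a P K γ)
include hD

omit [FiniteDimensional ℝ E] hB hx₀ hD in
theorem tendsto_zero_of_mem_spaceUMinus {v : E} (hv : v ∈ spaceUMinus A B x₀) :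
    Tendsto (fun x => evolution A B x₀ x v) atTop (𝓝 0) := by
  obtain ⟨β, hβ, h⟩ := hv
  refine h.trans_tendsto ?_
  exact Real.tendsto_exp_atBot.comp (tendsto_id.const_mul_atTop_of_neg (neg_lt_zero.2 hβ))

/-- Because QP = 0, one can factor QY⁻¹(s) = QY⁻¹(a) · Y(a)(1 - P)Y⁻¹(s) and use the unstable
estimate. -/
theorem norm_projection_evolutionInv_le {Q : E →L[ℝ] E} (hQ : ∀ v, Q (P v) = 0) :
    ∃ C, ∀ s, a ≤ s → ‖Q * evolutionInv A B x₀ s‖ ≤ C * Real.exp (-γ * s) := by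
  refine ⟨‖Q * evolutionInv A B x₀ a‖ * (K * Real.exp (γ * a)), fun s hs => ?_⟩
  have h1 : Q * evolutionInv A B x₀ s = (Q * evolutionInv A B x₀ a) *
      (evolution A B x₀ a * (1 - P) * evolutionInv A B x₀ s) := by
    ext v
    simp only [mul_apply_eq_comp, evolutionInv_apply hB hx₀ hD.pos, sub_apply, map_sub, hQ,
      one_apply_eq_self, sub_zero]
  rw [h1]
  calc _ ≤ ‖Q * evolutionInv A B x₀ a‖ * (K * Real.exp (-γ * (s - a))) :=
        (norm_mul_le _ _).trans
          (mul_le_mul_of_nonneg_left (hD.unstable s a le_rfl hs) (norm_nonneg _))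
    _ = _ := by
      rw [mul_assoc, mul_assoc, ← Real.exp_add]
      ring_nf

theorem tendsto_projection_evolutionInv {Q : E →L[ℝ] E} (hQ : ∀ v, Q (P v) = 0) {y : ℝ → E}
    (hy : Tendsto y atTop (𝓝 0)) :
    Tendsto (fun x => Q (evolutionInv A B x₀ x (y x))) atTop (𝓝 0) := by
  obtain ⟨C, hC⟩ := norm_projection_evolutionInv_le hB hx₀ hD hQ
  have h1 : Tendsto (fun x => C * Real.exp (-γ * x) * ‖y x‖) atTop (𝓝 0) := by
    have := ((Real.tendsto_exp_atBot.comp (tendsto_id.const_mul_atTop_of_neg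
      (neg_lt_zero.2 hD.γ_pos))).const_mul C).mul hy.norm
    simpa using this
  refine squeeze_zero_norm' ?_ h1
  filter_upwards [eventually_ge_atTop a] with x hx
  exact (Q * evolutionInv A B x₀ x).le_of_opNorm_le (hC x hx) _

theorem mem_spaceUMinus_of_projection {v : E} (hv : P v = v) : v ∈ spaceUMinus A B x₀ := by
  refine ⟨γ, hD.γ_pos, IsBigO.of_bound (K * Real.exp (γ * a) * ‖evolution A B x₀ a v‖) ?_⟩
  filter_upwards [eventually_ge_atTop a] with x hx
  have h1 : evolution A B x₀ x v = (evolution A B x₀ x * P * evolutionInv A B x₀ a)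
      (evolution A B x₀ a v) := by
    simp only [mul_apply_eq_comp, evolutionInv_apply hB hx₀ hD.pos, hv]
  rw [h1, Real.norm_of_nonneg (Real.exp_pos _).le]
  calc _ ≤ K * Real.exp (-γ * (x - a)) * ‖evolution A B x₀ a v‖ :=
        ContinuousLinearMap.le_of_opNorm_le _ (hD.stable a x le_rfl hx) _
    _ = K * (Real.exp (γ * a) * Real.exp (-γ * x)) * ‖evolution A B x₀ a v‖ := by
      rw [← Real.exp_add]; ring_nf
    _ = _ := by ring

/-- Applying (1 - P)Y⁻¹(x) to a decaying solution gives the constant (1 - P)v and also tends to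
zero. Together with `mem_spaceUMinus_of_projection` this identifies U₋ with the range of P. -/
theorem projection_eq_of_tendsto {v : E}
    (hv : Tendsto (fun x => evolution A B x₀ x v) atTop (𝓝 0)) : P v = v := by
  have h1 := tendsto_projection_evolutionInv hB hx₀ hD (Q := 1 - P)
    (fun w => by simp [hD.idem]) hv
  have h2 : Tendsto (fun _ : ℝ => (1 - P) v) atTop (𝓝 0) := by
    refine h1.congr' ?_
    filter_upwards [eventually_gt_atTop 0] with x hx
    rw [evolutionInv_apply hB hx₀ hx]
  have h3 := tendsto_nhds_unique tendsto_const_nhds h2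
  simp only [sub_apply, one_apply_eq_self, sub_eq_zero] at h3
  exact h3.symm

theorem projection_mem_spaceUMinus (v : E) : P v ∈ spaceUMinus A B x₀ :=
  mem_spaceUMinus_of_projection hB hx₀ hD (hD.idem v)

theorem integrableOn_Ioi_projection {Q : E →L[ℝ] E} (hQ : ∀ v ∈ spaceUMinus A B x₀, Q v = 0)
    {f : ℝ → E} (hf : ContinuousOn f (Ioi 0)) (hf_lim : Tendsto f atTop (𝓝 0)) {b : ℝ}
    (hb : 0 < b) : IntegrableOn (fun s => Q (evolutionInv A B x₀ s (f s))) (Ioi b) := by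
  obtain ⟨C, hC⟩ := norm_projection_evolutionInv_le hB hx₀ hD
    fun v => hQ _ (projection_mem_spaceUMinus hB hx₀ hD v)
  have hcont : ContinuousOn (fun s => Q (evolutionInv A B x₀ s (f s))) (Ioi 0) :=
    Q.continuous.comp_continuousOn ((continuousOn_evolutionInv hB hx₀).clm_apply hf)
  obtain ⟨T, hT⟩ := eventually_atTop.1
    (hf_lim.norm.eventually (ge_mem_nhds (show ‖(0 : E)‖ < 1 by simp)))
  set T' := max T (max a b)
  have hT' : b ≤ T' := (le_max_right a b).trans (le_max_right T _)
  have hfar : IntegrableOn (fun s => Q (evolutionInv A B x₀ s (f s))) (Ioi T') := by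
    refine ((integrableOn_exp_mul_Ioi (neg_lt_zero.2 hD.γ_pos) T').const_mul C).mono' ?_ ?_
    · exact (hcont.mono (Ioi_subset_Ioi (hb.le.trans hT'))).aestronglyMeasurable measurableSet_Ioi
    · refine (ae_restrict_mem measurableSet_Ioi).mono fun s hs => ?_
      have hs : T' < s := hs
      have h1 := (Q * evolutionInv A B x₀ s).le_of_opNorm_le_of_le
        (hC s (((le_max_left a b).trans (le_max_right T _)).trans hs.le))
        (hT s ((le_max_left T _).trans hs.le))
      simpa using h1
  rw [← Ioc_union_Ioi_eq_Ioi hT']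
  exact (intervalIntegrable_Ioi hcont hb (hb.trans_le hT')).1.union hfar

/-- Since QY⁻¹(x) decays, Q(c + ∫_{x₀}^x Y⁻¹f) = QY⁻¹(x)y(x) tends to zero; its limit is Qc plus the
improper integral. -/
theorem projection_eq_of_tendsto_atTop {Q : E →L[ℝ] E}
    (hQ : ∀ v ∈ spaceUMinus A B x₀, Q v = 0) {f : ℝ → E} (hf : ContinuousOn f (Ioi 0))
    (hf_lim : Tendsto f atTop (𝓝 0)) {c : E}
    (h : Tendsto (fun x => evolution A B x₀ x (c + ∫ s in x₀..x, evolutionInv A B x₀ s (f s)))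
      atTop (𝓝 0)) :
    Q c = -∫ s in Ioi x₀, Q (evolutionInv A B x₀ s (f s)) := by
  have := FiniteDimensional.complete ℝ E
  have h1 := tendsto_projection_evolutionInv hB hx₀ hD
    (fun v => hQ _ (projection_mem_spaceUMinus hB hx₀ hD v)) h
  have h2 := (intervalIntegral_tendsto_integral_Ioi x₀
    (integrableOn_Ioi_projection hB hx₀ hD hQ hf hf_lim hx₀) tendsto_id).const_add (Q c)
  refine eq_neg_of_add_eq_zero_left (tendsto_nhds_unique h2 (h1.congr' ?_))
  filter_upwards [eventually_gt_atTop 0] with x hx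
  rw [evolutionInv_apply hB hx₀ hx, map_add, ← Q.intervalIntegral_comp_comm (intervalIntegrable_Ioi
    ((continuousOn_evolutionInv hB hx₀).clm_apply hf) hx₀ hx)]
  rfl

/-- The classical solution for a dichotomy: integrate the stable part forward and the unstable part
back from infinity. -/
theorem exists_variation_tendsto {f : ℝ → E} (hf : ContinuousOn f (Ioi 0))
    (hf_lim : Tendsto f atTop (𝓝 0)) :
    ∃ c, Tendsto (fun x => evolution A B x₀ x (c + ∫ s in x₀..x, evolutionInv A B x₀ s (f s)))
      atTop (𝓝 0) := by
  have := FiniteDimensional.complete ℝ E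
  set F : ℝ → E := fun x => ∫ s in x₀..x, evolutionInv A B x₀ s (f s) with hFdef
  have hYf : ContinuousOn (fun s => evolutionInv A B x₀ s (f s)) (Ioi 0) :=
    (continuousOn_evolutionInv hB hx₀).clm_apply hf
  have hi : ∀ x y, 0 < x → 0 < y → IntervalIntegrable
      (fun s => evolutionInv A B x₀ s (f s)) volume x y := fun x y hx hy =>
    intervalIntegrable_Ioi hYf hx hy
  have hUP : ∀ v ∈ spaceUMinus A B x₀, (1 - P) v = 0 := fun v hv => by
    simp [projection_eq_of_tendsto hB hx₀ hD (tendsto_zero_of_mem_spaceUMinus hv)]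
  have hint : ∀ b, 0 < b → IntegrableOn (fun s => (1 - P) (evolutionInv A B x₀ s (f s))) (Ioi b) :=
    fun b hb => integrableOn_Ioi_projection hB hx₀ hD hUP hf hf_lim hb
  set c := -∫ s in Ioi x₀, (1 - P) (evolutionInv A B x₀ s (f s)) with hcdef
  have hPc : P c = 0 := by
    rw [hcdef, map_neg, ← P.integral_comp_comm (hint x₀ hx₀)]
    simp [hD.idem]
  have hQc : (1 - P) c = c := by simp [hPc]
  have hγ := hD.γ_pos
  have hK := hD.K_pos
  -- What was accumulated before T lies in the range of P and decays; after T, the stable and the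
  -- unstable integral cost Kε/γ each.
  have key : ∀ ε T, 0 < ε → a ≤ T → (∀ s, T ≤ s → ‖f s‖ ≤ ε) → ∀ x, T ≤ x →
      ‖evolution A B x₀ x (c + F x)‖ ≤
        ‖evolution A B x₀ x (P (F T))‖ + K * ε / γ + K * ε / γ := by
    intro ε T hε haT hT x hx
    have hT0 : 0 < T := hD.pos.trans_le haT
    have hx0 : 0 < x := hT0.trans_le hx
    have hFT : F x = F T + ∫ s in T..x, evolutionInv A B x₀ s (f s) := by
      rw [hFdef]
      exact (intervalIntegral.integral_add_adjacent_intervals (hi _ _ hx₀ hT0)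
        (hi _ _ hT0 hx0)).symm
    have hsplit : c + F x = P (F T) + P (∫ s in T..x, evolutionInv A B x₀ s (f s)) -
        ∫ s in Ioi x, (1 - P) (evolutionInv A B x₀ s (f s)) := by
      have h1 : c + F x = P (c + F x) + (1 - P) (c + F x) := by simp
      have h2 : (1 - P) (c + F x) = -∫ s in Ioi x, (1 - P) (evolutionInv A B x₀ s (f s)) := by
        rw [map_add, hQc, hcdef, hFdef, ← (1 - P).intervalIntegral_comp_comm (hi _ _ hx₀ hx0),
          ← intervalIntegral.integral_interval_add_Ioi (hint x₀ hx₀) (hint x hx0)]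
        abel
      rw [h1, h2, map_add, hPc, zero_add, hFT, map_add]
      exact (sub_eq_add_neg _ _).symm
    have hb1 : ‖evolution A B x₀ x (P (∫ s in T..x, evolutionInv A B x₀ s (f s)))‖ ≤
        K * ε / γ := by
      have hexp : ∀ s, HasDerivAt (fun s => K * ε / γ * Real.exp (-γ * (x - s)))
          (K * ε * Real.exp (-γ * (x - s))) s := by
        intro s
        refine (((((hasDerivAt_id s).const_sub x).const_mul (-γ)).exp).const_mul
          (K * ε / γ)).congr_deriv ?_
        simp only [id]
        field_simp
      have h1 : evolution A B x₀ x (P (∫ s in T..x, evolutionInv A B x₀ s (f s))) =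
          ∫ s in T..x, (evolution A B x₀ x * P * evolutionInv A B x₀ s) (f s) :=
        ((evolution A B x₀ x * P).intervalIntegral_comp_comm (hi _ _ hT0 hx0)).symm
      have hci : Continuous fun s => K * ε * Real.exp (-γ * (x - s)) := by fun_prop
      rw [h1]
      calc _ ≤ ∫ s in T..x, K * ε * Real.exp (-γ * (x - s)) := by
            refine intervalIntegral.norm_integral_le_of_norm_le hx (ae_of_all _ fun s hs => ?_)
              (hci.intervalIntegrable _ _)
            refine (ContinuousLinearMap.le_of_opNorm_le_of_le _
              (hD.stable s x (haT.trans hs.1.le) hs.2) (hT s hs.1.le)).trans_eq (by ring)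
        _ = K * ε / γ * Real.exp (-γ * (x - x)) - K * ε / γ * Real.exp (-γ * (x - T)) :=
          intervalIntegral.integral_eq_sub_of_hasDerivAt (fun s _ => hexp s)
            (hci.intervalIntegrable _ _)
        _ ≤ _ := by
          have : 0 ≤ K * ε / γ * Real.exp (-γ * (x - T)) := by positivity
          simp only [sub_self, mul_zero, Real.exp_zero, mul_one]
          linarith
    have hb2 : ‖evolution A B x₀ x (∫ s in Ioi x, (1 - P) (evolutionInv A B x₀ s (f s)))‖ ≤
        K * ε / γ := by
      rw [← (evolution A B x₀ x).integral_comp_comm (hint x hx0)]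
      have hexp := (integrableOn_exp_mul_Ioi (neg_lt_zero.2 hγ) x).const_mul
        (K * ε * Real.exp (γ * x))
      calc _ ≤ ∫ s in Ioi x, K * ε * Real.exp (γ * x) * Real.exp (-γ * s) := by
            refine norm_integral_le_of_norm_le hexp
              ((ae_restrict_mem measurableSet_Ioi).mono fun s hs => ?_)
            have hs : x < s := hs
            have h1 : K * ε * Real.exp (γ * x) * Real.exp (-γ * s) =
                K * Real.exp (-γ * (s - x)) * ε := by
              rw [mul_assoc, ← Real.exp_add]; ring_nf
            rw [h1]
            exact ContinuousLinearMap.le_of_opNorm_le_of_le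
              (evolution A B x₀ x * (1 - P) * evolutionInv A B x₀ s)
              (hD.unstable s x (haT.trans hx) hs.le) (hT s (hx.trans hs.le))
        _ = K * ε / γ * (Real.exp (γ * x) * Real.exp (-γ * x)) := by
          rw [integral_const_mul, integral_exp_mul_Ioi (neg_lt_zero.2 hγ), neg_div_neg_eq]
          ring
        _ = _ := by rw [← Real.exp_add]; simp
    rw [hsplit, map_sub, map_add]
    exact (norm_sub_le _ _).trans (add_le_add ((norm_add_le _ _).trans (add_le_add le_rfl hb1)) hb2)
  refine ⟨c, ?_⟩
  rw [Metric.tendsto_nhds]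
  intro η hη
  -- Makes each Kε/γ equal to η/4, leaving η/2 for the decaying term.
  have hε : 0 < γ * η / (4 * K) := by positivity
  obtain ⟨T, hT⟩ := eventually_atTop.1
    (hf_lim.norm.eventually (ge_mem_nhds (show ‖(0 : E)‖ < γ * η / (4 * K) by simpa using hε)))
  have h1 := tendsto_zero_of_mem_spaceUMinus
    (projection_mem_spaceUMinus hB hx₀ hD (F (max a T)))
  have h2 := h1.norm.eventually (gt_mem_nhds (show ‖(0 : E)‖ < η / 2 by simpa using half_pos hη))
  filter_upwards [h2, eventually_ge_atTop (max a T)] with x hx1 hx2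
  have h3 := key _ _ hε (le_max_left a T) (fun s hs => hT s ((le_max_right a T).trans hs)) x hx2
  have h4 : K * (γ * η / (4 * K)) / γ = η / 4 := by field_simp
  rw [h4] at h3
  rw [dist_zero_right]
  linarith

/-- Superposition, as at zero: c differs from the constant of a decaying solution by an element of
ker Q = U₋. -/
theorem tendsto_atTop_of_projection_eq {Q : E →L[ℝ] E}
    (hQ : ∀ v, v ∈ spaceUMinus A B x₀ ↔ Q v = 0) {f : ℝ → E} (hf : ContinuousOn f (Ioi 0))
    (hf_lim : Tendsto f atTop (𝓝 0)) {c : E}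
    (h : Q c = -∫ s in Ioi x₀, Q (evolutionInv A B x₀ s (f s))) :
    Tendsto (fun x => evolution A B x₀ x (c + ∫ s in x₀..x, evolutionInv A B x₀ s (f s)))
      atTop (𝓝 0) := by
  obtain ⟨c₁, h1⟩ := exists_variation_tendsto hB hx₀ hD hf hf_lim
  have h2 := projection_eq_of_tendsto_atTop hB hx₀ hD (fun v hv => (hQ v).1 hv) hf hf_lim h1
  have h3 : c - c₁ ∈ spaceUMinus A B x₀ := by
    rw [hQ, map_sub, h, h2, sub_self]
  have h4 := (tendsto_zero_of_mem_spaceUMinus h3).add h1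
  rw [add_zero] at h4
  refine h4.congr fun x => ?_
  rw [← map_add]
  congr 1
  abel

end Infinity

/-! ### Algebra of the six projectors -/

section Projectors

variable {E : Type*} [NormedAddCommGroup E] [NormedSpace ℝ E] [FiniteDimensional ℝ E]
  {A : E →L[ℝ] E} {B : ℝ → E →L[ℝ] E} {x₀ : ℝ} {V0 : Submodule ℝ E} {L : Fin 6 → Submodule ℝ E}
  (hL : IsSplitting A B x₀ V0 L)
include hL

theorem proj_apply (i : Fin 6) (v : E) :
    proj L i v = (L i).projection _ (hL.isCompl i) v := by
  rw [proj, dif_pos (hL.isCompl i)]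
  rfl

theorem proj_mem (i : Fin 6) (v : E) : proj L i v ∈ L i := by
  rw [proj_apply hL]
  exact Submodule.projection_apply_mem _ _

theorem proj_of_mem {i : Fin 6} {v : E} (hv : v ∈ L i) : proj L i v = v := by
  rw [proj_apply hL]
  exact Submodule.projection_apply_of_mem_left _ hv

theorem proj_of_mem_ne {i j : Fin 6} (hij : i ≠ j) {v : E} (hv : v ∈ L i) : proj L j v = 0 := by
  rw [proj_apply hL, Submodule.projection_apply_eq_zero_iff]
  exact Submodule.mem_iSup_of_mem i (Submodule.mem_iSup_of_mem hij hv)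

theorem proj_proj_ne {i j : Fin 6} (hij : i ≠ j) (v : E) : proj L j (proj L i v) = 0 :=
  proj_of_mem_ne hL hij (proj_mem hL i v)

theorem proj_proj (i : Fin 6) (v : E) : proj L i (proj L i v) = proj L i v :=
  proj_of_mem hL (proj_mem hL i v)

theorem sum_proj (v : E) : ∑ i, proj L i v = v := by
  have hv : v ∈ ⨆ i, L i := by
    have h : (⨆ i, L i) = ⊤ := by
      rw [eq_top_iff, ← (hL.isCompl 0).sup_eq_top]
      exact sup_le (le_iSup L 0) (iSup_le fun j => iSup_le fun _ => le_iSup L j)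
    rw [h]
    exact Submodule.mem_top
  refine Submodule.iSup_induction L (motive := fun v => ∑ i, proj L i v = v) hv
    (fun i w hw => ?_) (by simp) fun u w hu hw => ?_
  · rw [Finset.sum_eq_single i (fun j _ hj => proj_of_mem_ne hL hj.symm hw) (by simp),
      proj_of_mem hL hw]
  · simp only [map_add, Finset.sum_add_distrib, hu, hw]

/-- V₊ = L₁ ⊕ L₄, so it is the common kernel of P₂, P₃, P₅, P₆. -/
theorem mem_spaceVPlus_iff_proj {v : E} : v ∈ spaceVPlus A B x₀ ↔
    (proj L 1 + proj L 2 + proj L 4 + proj L 5) v = 0 := by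
  rw [← hL.sup_L4]
  constructor
  · intro h
    obtain ⟨u, hu, w, hw, rfl⟩ := Submodule.mem_sup.1 h
    have h1 : ∀ j : Fin 6, j ≠ 0 → proj L j u = 0 := fun j hj => proj_of_mem_ne hL hj.symm hu
    have h2 : ∀ j : Fin 6, j ≠ 3 → proj L j w = 0 := fun j hj => proj_of_mem_ne hL hj.symm hw
    simp [h1, h2]
  · intro h
    have h1 := sum_proj hL v
    rw [Fin.sum_univ_six] at h1
    simp only [add_apply] at h
    have h2 : v = proj L 0 v + proj L 3 v := by
      calc v = proj L 0 v + proj L 3 v +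
            (proj L 1 v + proj L 2 v + proj L 4 v + proj L 5 v) := by
            nth_rw 1 [← h1]; abel
        _ = _ := by rw [h, add_zero]
    rw [h2]
    exact Submodule.add_mem_sup (proj_mem hL 0 v) (proj_mem hL 3 v)

/-- U₋ = L₁ ⊕ L₂ ⊕ L₃, so it is the common kernel of P₄, P₅, P₆. -/
theorem mem_spaceUMinus_iff_proj {v : E} : v ∈ spaceUMinus A B x₀ ↔
    (proj L 3 + proj L 4 + proj L 5) v = 0 := by
  rw [← hL.sup_L3, ← hL.sup_L2]
  constructor
  · intro h
    obtain ⟨t, ht, r, hr, rfl⟩ := Submodule.mem_sup.1 h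
    obtain ⟨u, hu, w, hw, rfl⟩ := Submodule.mem_sup.1 ht
    have h1 : ∀ j : Fin 6, j ≠ 0 → proj L j u = 0 := fun j hj => proj_of_mem_ne hL hj.symm hu
    have h2 : ∀ j : Fin 6, j ≠ 1 → proj L j w = 0 := fun j hj => proj_of_mem_ne hL hj.symm hw
    have h3 : ∀ j : Fin 6, j ≠ 2 → proj L j r = 0 := fun j hj => proj_of_mem_ne hL hj.symm hr
    simp [h1, h2, h3]
  · intro h
    have h1 := sum_proj hL v
    rw [Fin.sum_univ_six] at h1
    simp only [add_apply] at h
    have h2 : v = proj L 0 v + proj L 1 v + proj L 2 v := by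
      calc v = proj L 0 v + proj L 1 v + proj L 2 v +
            (proj L 3 v + proj L 4 v + proj L 5 v) := by
            nth_rw 1 [← h1]; abel
        _ = _ := by rw [h, add_zero]
    rw [h2]
    exact Submodule.add_mem_sup (Submodule.add_mem_sup (proj_mem hL 0 v) (proj_mem hL 1 v))
      (proj_mem hL 2 v)

end Projectors

/-! ### Integrals of the two kernels -/

section GreenIntegrals

variable {E : Type*} [NormedAddCommGroup E] [NormedSpace ℝ E] [FiniteDimensional ℝ E]
  {A : E →L[ℝ] E} {B : ℝ → E →L[ℝ] E} (hB : ContinuousOn B (Ici 0)) {x₀ : ℝ} (hx₀ : 0 < x₀)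
  (L : Fin 6 → Submodule ℝ E) {g : ℝ → E}
include hx₀

include hB in
-- For fixed x the kernel lives on the segment between x₀ and x, and its sign is the orientation of
-- the integral from x₀ to x; the L₁ part thus needs no convergence at either end.
theorem integral_green1 (hg : ContinuousOn g (Ioi 0)) {x : ℝ} (hx : 0 < x) :
    IntegrableOn (fun s => green1 A B x₀ L x s (g s)) (Ioi 0) ∧
      ∫ s in Ioi 0, green1 A B x₀ L x s (g s) =
        evolution A B x₀ x (proj L 0 (∫ s in x₀..x, evolutionInv A B x₀ s (g s))) := by
  have := FiniteDimensional.complete ℝ E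
  set h : ℝ → E := fun s => (evolution A B x₀ x * proj L 0) (evolutionInv A B x₀ s (g s))
  have hYg : ContinuousOn (fun s => evolutionInv A B x₀ s (g s)) (Ioi 0) :=
    (continuousOn_evolutionInv hB hx₀).clm_apply hg
  have hh : ContinuousOn h (Ioi 0) := (ContinuousLinearMap.continuous _).comp_continuousOn hYg
  have hI : evolution A B x₀ x (proj L 0 (∫ s in x₀..x, evolutionInv A B x₀ s (g s))) =
      ∫ s in x₀..x, h s :=
    ((evolution A B x₀ x * proj L 0).intervalIntegral_comp_comm
      (intervalIntegrable_Ioi hYg hx₀ hx)).symm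
  rw [hI]
  rcases le_or_gt x₀ x with hxx | hxx
  · have hG : (fun s => green1 A B x₀ L x s (g s)) = (Icc x₀ x).indicator h := by
      ext s
      by_cases hs : s ∈ Icc x₀ x
      · have h1 : (x, s) ∈ setD x₀ ∩ setDPlus :=
          ⟨Or.inr ⟨hs.1, hs.2⟩, hx₀.trans_le hs.1, hs.2⟩
        rw [indicator_of_mem hs, green1, if_pos h1]
        rfl
      · have h1 : (x, s) ∉ setD x₀ := by
          rintro (h1 | h1)
          · exact absurd (h1.2.1.trans h1.2.2) (not_lt.2 hxx)
          · exact hs h1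
        rw [indicator_of_notMem hs, green1, if_neg fun h2 => h1 h2.1, if_neg fun h2 => h1 h2.1,
          zero_apply]
    have hsub : Icc x₀ x ⊆ Ioi 0 := fun s hs => hx₀.trans_le hs.1
    rw [hG]
    constructor
    · exact ((integrable_indicator_iff measurableSet_Icc).2
        ((hh.mono hsub).integrableOn_compact isCompact_Icc)).integrableOn
    · rw [setIntegral_indicator measurableSet_Icc, inter_eq_right.2 hsub,
        integral_Icc_eq_integral_Ioc, intervalIntegral.integral_of_le hxx]
  · have hG : (fun s => green1 A B x₀ L x s (g s)) = (Ioo x x₀).indicator (-h) := by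
      ext s
      have h0 : (x, s) ∉ setD x₀ ∩ setDPlus := by
        rintro ⟨h1 | h1, h2⟩
        · exact absurd h1.2.1 (not_lt.2 h2.2)
        · exact absurd (h1.1.trans h1.2) (not_le.2 hxx)
      by_cases hs : s ∈ Ioo x x₀
      · have h1 : (x, s) ∈ setD x₀ ∩ setDMinus := ⟨Or.inl ⟨hx, hs.1, hs.2⟩, hx, hs.1⟩
        rw [indicator_of_mem hs, green1, if_neg h0, if_pos h1]
        rfl
      · have h1 : (x, s) ∉ setD x₀ := by
          rintro (h1 | h1)
          · exact hs h1.2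
          · exact absurd (h1.1.trans h1.2) (not_le.2 hxx)
        rw [indicator_of_notMem hs, green1, if_neg fun h2 => h1 h2.1, if_neg fun h2 => h1 h2.1,
          zero_apply]
    have hsub : Icc x x₀ ⊆ Ioi 0 := fun s hs => hx.trans_le hs.1
    rw [hG]
    constructor
    · exact ((integrable_indicator_iff measurableSet_Ioo).2
        ((((hh.mono hsub).integrableOn_compact isCompact_Icc).mono_set
          Ioo_subset_Icc_self).neg)).integrableOn
    · rw [setIntegral_indicator measurableSet_Ioo,
        inter_eq_right.2 (Ioo_subset_Icc_self.trans hsub), intervalIntegral.integral_of_ge hxx.le,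
        integral_Ioc_eq_integral_Ioo]
      exact integral_neg _

omit hx₀ in
theorem integral_green2 {x : ℝ} (hx : 0 < x)
    (h1 : IntegrableOn (fun s => (proj L 1 + proj L 2) (evolutionInv A B x₀ s (g s))) (Ioc 0 x))
    (h2 : IntegrableOn (fun s => (proj L 3 + proj L 4 + proj L 5) (evolutionInv A B x₀ s (g s)))
      (Ioi x)) :
    IntegrableOn (fun s => green2 A B x₀ L x s (g s)) (Ioi 0) ∧
      ∫ s in Ioi 0, green2 A B x₀ L x s (g s) =
        evolution A B x₀ x
          ((∫ s in Ioc 0 x, (proj L 1 + proj L 2) (evolutionInv A B x₀ s (g s))) -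
            ∫ s in Ioi x, (proj L 3 + proj L 4 + proj L 5) (evolutionInv A B x₀ s (g s))) := by
  have := FiniteDimensional.complete ℝ E
  have e1 : EqOn (fun s => green2 A B x₀ L x s (g s)) (fun s => evolution A B x₀ x
      ((proj L 1 + proj L 2) (evolutionInv A B x₀ s (g s)))) (Ioc 0 x) := by
    intro s hs
    have h3 : (x, s) ∈ setDPlus := hs
    simp only [green2, if_pos h3, mul_apply_eq_comp]
  have e2 : EqOn (fun s => green2 A B x₀ L x s (g s)) (fun s => -evolution A B x₀ x
      ((proj L 3 + proj L 4 + proj L 5) (evolutionInv A B x₀ s (g s)))) (Ioi x) := by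
    intro s hs
    have h3 : (x, s) ∉ setDPlus := fun h => absurd h.2 (not_le.2 hs)
    have h4 : (x, s) ∈ setDMinus := ⟨hx, hs⟩
    simp only [green2, if_neg h3, if_pos h4, mul_apply_eq_comp, neg_apply]
  have i1 : IntegrableOn (fun s => green2 A B x₀ L x s (g s)) (Ioc 0 x) :=
    ((evolution A B x₀ x).integrable_comp h1).congr
      ((ae_restrict_mem measurableSet_Ioc).mono fun s hs => (e1 hs).symm)
  have i2 : IntegrableOn (fun s => green2 A B x₀ L x s (g s)) (Ioi x) :=
    (((evolution A B x₀ x).integrable_comp h2).neg).congr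
      ((ae_restrict_mem measurableSet_Ioi).mono fun s hs => (e2 hs).symm)
  rw [← Ioc_union_Ioi_eq_Ioi hx.le]
  refine ⟨i1.union i2, ?_⟩
  rw [setIntegral_union (Ioc_disjoint_Ioi le_rfl) measurableSet_Ioi i1 i2,
    setIntegral_congr_fun measurableSet_Ioc e1, setIntegral_congr_fun measurableSet_Ioi e2,
    integral_neg, ContinuousLinearMap.integral_comp_comm _ h1,
    ContinuousLinearMap.integral_comp_comm _ h2, map_sub, sub_eq_add_neg]

end GreenIntegrals

/-! ### Reduction of the boundary value problem to its constant -/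

section BoundaryValueProblem

variable {E : Type*} [NormedAddCommGroup E] [InnerProductSpace ℝ E] [FiniteDimensional ℝ E]
  {A : E →L[ℝ] E} {B : ℝ → E →L[ℝ] E}
  (hB : ContinuousOn B (Ici 0)) (hB_bdd : ∃ M, ∀ x, 0 ≤ x → ‖B x‖ ≤ M)
  (hA : ∀ z : ℂ, Polynomial.aeval z (LinearMap.charpoly (A : E →ₗ[ℝ] E)) = 0 → z.re ≠ 1)
  {x₀ : ℝ} (hx₀ : 0 < x₀) {g : ℝ → E} (hg : ContinuousOn g (Ici 0))
include hB hB_bdd hA hx₀ hg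

/-- The solutions of the boundary value problem in terms of the behaviour of the variation of
constants formula at both ends. -/
theorem isBVPSolution_iff {y : ℝ → E} : IsBVPSolution A B g y ↔ y 0 = 0 ∧ ∃ c : E,
    (∀ x, 0 < x →
      y x = evolution A B x₀ x (c + ∫ s in x₀..x, evolutionInv A B x₀ s (g s))) ∧
    (fun x => evolution A B x₀ x (c + ∫ s in x₀..x, evolutionInv A B x₀ s (g s)))
      =O[𝓝[>] 0] (fun x : ℝ => x) ∧
    Tendsto (fun x => evolution A B x₀ x (c + ∫ s in x₀..x, evolutionInv A B x₀ s (g s)))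
      atTop (𝓝 0) := by
  have hg' : ContinuousOn g (Ioi 0) := hg.mono Ioi_subset_Ici_self
  constructor
  · intro hy
    obtain ⟨hy0, hO⟩ := isBigO_of_contDiffOn hy.contDiffOn hy.tendsto_zero
    obtain ⟨c, hc⟩ := exists_variation hB hx₀ (A := A) hg' isOpen_Ioi isPreconnected_Ioi subset_rfl
      hy.hasDerivAt
    refine ⟨hy0, c, hc, hO.congr' ?_ EventuallyEq.rfl, hy.tendsto_atTop.congr' ?_⟩
    · filter_upwards [self_mem_nhdsWithin] with x hx using hc x hx
    · filter_upwards [eventually_gt_atTop 0] with x hx using hc x hx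
  · rintro ⟨hy0, c, hc, hO, hlim⟩
    have hd : ∀ x, 0 < x → HasDerivAt y (coeff A B x (y x) + g x) x := by
      intro x hx
      rw [hc x hx]
      refine (hasDerivAt_variation hB hx₀ hg' c hx).congr_of_eventuallyEq ?_
      filter_upwards [Ioi_mem_nhds hx] with s hs using hc s hs
    have hO' : y =O[𝓝[>] 0] fun x : ℝ => x := by
      refine hO.congr' ?_ EventuallyEq.rfl
      filter_upwards [self_mem_nhdsWithin] with x hx using (hc x hx).symm
    refine ⟨contDiffOn_of_isBigO hB_bdd hB hA hg hd hy0 hO', hd,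
      hO'.trans_tendsto (tendsto_id.mono_left nhdsWithin_le_nhds), hlim.congr' ?_⟩
    filter_upwards [eventually_gt_atTop 0] with x hx using (hc x hx).symm

variable {a : ℝ} {P : E →L[ℝ] E} {K γ : ℝ} (hD : DichotomyWith A B x₀ a P K γ)
  (hg_lim : Tendsto g atTop (𝓝 0)) {V0 : Submodule ℝ E} {L : Fin 6 → Submodule ℝ E}
  (hL : IsSplitting A B x₀ V0 L)
include hD hg_lim hL

omit hD hg_lim in
-- Both sums avoid P₁ and P₄, hence vanish on V₊ = L₁ ⊕ L₄.
theorem integrableOn_proj_zero :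
    (∀ b, IntegrableOn (fun s => (proj L 1 + proj L 2) (evolutionInv A B x₀ s (g s)))
      (Ioc 0 b)) ∧
    (∀ b, IntegrableOn (fun s => (proj L 4 + proj L 5) (evolutionInv A B x₀ s (g s)))
      (Ioc 0 b)) := by
  have h : ∀ v ∈ spaceVPlus A B x₀, ∀ i : Fin 6, i ≠ 0 → i ≠ 3 → proj L i v = 0 := by
    intro v hv i h0 h3
    rw [← hL.sup_L4] at hv
    obtain ⟨u, hu, w, hw, rfl⟩ := Submodule.mem_sup.1 hv
    rw [map_add, proj_of_mem_ne hL h0.symm hu, proj_of_mem_ne hL h3.symm hw, add_zero]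
  constructor
  · exact fun b => integrableOn_Ioc_projection hB hB_bdd hA hx₀
      (fun v hv => by simp [h v hv]) hg b
  · exact fun b => integrableOn_Ioc_projection hB hB_bdd hA hx₀
      (fun v hv => by simp [h v hv]) hg b

omit hB_bdd hA in
theorem integrableOn_proj_infinity :
    (∀ b, 0 < b → IntegrableOn
      (fun s => (proj L 3 + proj L 4 + proj L 5) (evolutionInv A B x₀ s (g s))) (Ioi b)) ∧
    (∀ b, 0 < b → IntegrableOn
      (fun s => (proj L 4 + proj L 5) (evolutionInv A B x₀ s (g s))) (Ioi b)) := by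
  have hg' : ContinuousOn g (Ioi 0) := hg.mono Ioi_subset_Ici_self
  have hU : ∀ v ∈ spaceUMinus A B x₀, (proj L 3 + proj L 4 + proj L 5) v = 0 :=
    fun v hv => (mem_spaceUMinus_iff_proj hL).1 hv
  refine ⟨fun b hb => integrableOn_Ioi_projection hB hx₀ hD hU hg' hg_lim hb,
    fun b hb => integrableOn_Ioi_projection hB hx₀ hD (fun v hv => ?_) hg' hg_lim hb⟩
  -- P₅ + P₆ absorbs P₄ + P₅ + P₆ on its right, so it also vanishes on U₋.
  have h1 := congrArg (proj L 4 + proj L 5) (hU v hv)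
  simpa [proj_proj hL, proj_proj_ne hL] using h1

/-- The Green function gives a solution of the differential equation, of the form of the variation
of constants formula. -/
theorem integral_green {x : ℝ} (hx : 0 < x) :
    IntegrableOn (fun s => green A B x₀ L x s (g s)) (Ioi 0) ∧
      ∫ s in Ioi 0, green A B x₀ L x s (g s) =
        evolution A B x₀ x
          ((∫ s in Ioc 0 x₀, (proj L 1 + proj L 2) (evolutionInv A B x₀ s (g s))) -
            (∫ s in Ioi x₀, (proj L 3 + proj L 4 + proj L 5) (evolutionInv A B x₀ s (g s))) +
            ∫ s in x₀..x, evolutionInv A B x₀ s (g s)) := by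
  have := FiniteDimensional.complete ℝ E
  have hg' : ContinuousOn g (Ioi 0) := hg.mono Ioi_subset_Ici_self
  have hYg : ContinuousOn (fun s => evolutionInv A B x₀ s (g s)) (Ioi 0) :=
    (continuousOn_evolutionInv hB hx₀).clm_apply hg'
  have hz := (integrableOn_proj_zero hB hB_bdd hA hx₀ hg hL).1
  have hi := (integrableOn_proj_infinity hB hx₀ hg hD hg_lim hL).1
  obtain ⟨i1, e1⟩ := integral_green1 hB hx₀ L hg' hx
  obtain ⟨i2, e2⟩ := integral_green2 L hx (hz x) (hi x hx)
  have hG : (fun s => green A B x₀ L x s (g s)) =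
      fun s => green1 A B x₀ L x s (g s) + green2 A B x₀ L x s (g s) := rfl
  rw [hG]
  refine ⟨i1.add i2, ?_⟩
  rw [integral_add i1 i2, e1, e2, ← map_add]
  congr 1
  set F := ∫ s in x₀..x, evolutionInv A B x₀ s (g s) with hF
  have hint := intervalIntegrable_Ioi hYg hx₀ hx
  have h1 : (∫ s in Ioc 0 x, (proj L 1 + proj L 2) (evolutionInv A B x₀ s (g s))) =
      (∫ s in Ioc 0 x₀, (proj L 1 + proj L 2) (evolutionInv A B x₀ s (g s))) +
        (proj L 1 + proj L 2) F := by
    rw [hF, ← ContinuousLinearMap.intervalIntegral_comp_comm _ hint,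
      ← intervalIntegral.integral_of_le hx.le, ← intervalIntegral.integral_of_le hx₀.le,
      intervalIntegral.integral_add_adjacent_intervals
        ((intervalIntegrable_iff_integrableOn_Ioc_of_le hx₀.le).2 (hz x₀))]
    exact intervalIntegrable_Ioi
      ((proj L 1 + proj L 2).continuous.comp_continuousOn hYg) hx₀ hx
  have h2 : (∫ s in Ioi x, (proj L 3 + proj L 4 + proj L 5) (evolutionInv A B x₀ s (g s))) =
      (∫ s in Ioi x₀, (proj L 3 + proj L 4 + proj L 5) (evolutionInv A B x₀ s (g s))) -
        (proj L 3 + proj L 4 + proj L 5) F := by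
    rw [hF, ← ContinuousLinearMap.intervalIntegral_comp_comm _ hint,
      ← intervalIntegral.integral_interval_add_Ioi (hi x₀ hx₀) (hi x hx)]
    abel
  rw [h1, h2]
  -- Moving the splitting point from x to x₀ costs (P₂ + ⋯ + P₆)F; with P₁F from the first kernel
  -- this is all of F.
  have h3 := sum_proj hL F
  rw [Fin.sum_univ_six] at h3
  nth_rw 4 [← h3]
  simp only [add_apply]
  abel

end BoundaryValueProblem

end SingularODE

/-! ### Solvability criterion and solution formula -/

theorem mainTheorem3 {E : Type*} [NormedAddCommGroup E] [InnerProductSpace ℝ E]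
    [FiniteDimensional ℝ E]
    (A : E →L[ℝ] E) (B : ℝ → E →L[ℝ] E)
    (hB : ContinuousOn B (Ici 0)) (hB_bdd : ∃ M, ∀ x, 0 ≤ x → ‖B x‖ ≤ M)
    (hA : ∀ z : ℂ, Polynomial.aeval z (LinearMap.charpoly (A : E →ₗ[ℝ] E)) = 0 → z.re ≠ 1)
    (hdich : ∃ a, 0 < a ∧ SingularODE.IsExpDichotomic A B a)
    (x₀ : ℝ) (hx₀ : 0 < x₀)
    (V0 : Submodule ℝ E) (L : Fin 6 → Submodule ℝ E)
    (hL : SingularODE.IsSplitting A B x₀ V0 L)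
    (g : ℝ → E) (hg : ContinuousOn g (Ici 0)) (hg_lim : Tendsto g atTop (𝓝 0)) :
    IntegrableOn
      (fun s => (SingularODE.proj L 4 + SingularODE.proj L 5)
        (SingularODE.evolutionInv A B x₀ s (g s))) (Ioi 0) ∧
    (∀ x, 0 < x → IntegrableOn (fun s => SingularODE.green A B x₀ L x s (g s)) (Ioi 0)) ∧
    ((∃ y : ℝ → E, SingularODE.IsBVPSolution A B g y) ↔
      (∫ s in Ioi (0 : ℝ), (SingularODE.proj L 4 + SingularODE.proj L 5)
        (SingularODE.evolutionInv A B x₀ s (g s))) = 0) ∧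
    ((∫ s in Ioi (0 : ℝ), (SingularODE.proj L 4 + SingularODE.proj L 5)
        (SingularODE.evolutionInv A B x₀ s (g s))) = 0 →
      ∀ y : ℝ → E, SingularODE.IsBVPSolution A B g y ↔
        y 0 = 0 ∧ ∃ v ∈ L 0, ∀ x, 0 < x →
          y x = SingularODE.evolution A B x₀ x v +
            ∫ s in Ioi (0 : ℝ), SingularODE.green A B x₀ L x s (g s)) := by
  open SingularODE in
  have := FiniteDimensional.complete ℝ E
  obtain ⟨a, ha, hdich⟩ := hdich
  obtain ⟨P, K, γ, hD⟩ := exists_dichotomyWith hB hx₀ ha hdich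
  have hg' : ContinuousOn g (Ioi 0) := hg.mono Ioi_subset_Ici_self
  obtain ⟨hz1, hz2⟩ := integrableOn_proj_zero hB hB_bdd hA hx₀ hg hL
  obtain ⟨hi1, hi2⟩ := integrableOn_proj_infinity hB hx₀ hg hD hg_lim hL
  -- Q₀ has kernel V₊ and Q has kernel U₋, so they express the conditions at the two ends. R is what
  -- they share: R = RQ₀ = RQ = Q₀Q.
  set R := proj L 4 + proj L 5 with hR
  set S := proj L 1 + proj L 2 with hS
  set Q := proj L 3 + proj L 4 + proj L 5 with hQ
  set Q₀ := proj L 1 + proj L 2 + proj L 4 + proj L 5 with hQ₀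
  have hQ₀eq : ∀ v, Q₀ v = S v + R v := fun v => by
    simp only [hQ₀, hS, hR, add_apply]; abel
  have hSS : ∀ v, Q₀ (S v) = S v := fun v => by
    simp [hQ₀, hS, proj_proj hL, proj_proj_ne hL]
  have hQS : ∀ v, Q (S v) = 0 := fun v => by
    simp [hQ, hS, proj_proj_ne hL]
  have hQQ : ∀ v, Q (Q v) = Q v := fun v => by
    simp [hQ, proj_proj hL, proj_proj_ne hL]
  have hQ₀Q : ∀ v, Q₀ (Q v) = R v := fun v => by
    simp [hQ₀, hQ, hR, proj_proj hL, proj_proj_ne hL]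
  have hRQ₀ : ∀ v, R (Q₀ v) = R v := fun v => by
    simp [hQ₀, hR, proj_proj hL, proj_proj_ne hL]
  have hRQ : ∀ v, R (Q v) = R v := fun v => by
    simp [hQ, hR, proj_proj hL, proj_proj_ne hL]
  have hV : ∀ v, v ∈ spaceVPlus A B x₀ ↔ Q₀ v = 0 := fun v => mem_spaceVPlus_iff_proj hL
  have hU : ∀ v, v ∈ spaceUMinus A B x₀ ↔ Q v = 0 := fun v => mem_spaceUMinus_iff_proj hL
  have hRint : IntegrableOn (fun s => R (evolutionInv A B x₀ s (g s))) (Ioi 0) := by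
    rw [← Ioc_union_Ioi_eq_Ioi hx₀.le]
    exact (hz2 x₀).union (hi2 x₀ hx₀)
  have hRsplit : (∫ s in Ioi (0 : ℝ), R (evolutionInv A B x₀ s (g s))) =
      (∫ s in Ioc 0 x₀, R (evolutionInv A B x₀ s (g s))) +
        ∫ s in Ioi x₀, R (evolutionInv A B x₀ s (g s)) := by
    rw [← Ioc_union_Ioi_eq_Ioi hx₀.le]
    exact setIntegral_union (Ioc_disjoint_Ioi le_rfl) measurableSet_Ioi (hz2 x₀) (hi2 x₀ hx₀)
  set c₀ := (∫ s in Ioc 0 x₀, S (evolutionInv A B x₀ s (g s))) -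
    ∫ s in Ioi x₀, Q (evolutionInv A B x₀ s (g s)) with hc₀
  have hgreen : ∀ x, 0 < x → IntegrableOn (fun s => green A B x₀ L x s (g s)) (Ioi 0) ∧
      ∫ s in Ioi 0, green A B x₀ L x s (g s) =
        evolution A B x₀ x (c₀ + ∫ s in x₀..x, evolutionInv A B x₀ s (g s)) :=
    fun x hx => integral_green hB hB_bdd hA hx₀ hg hD hg_lim hL hx
  have hsolve := fun y => isBVPSolution_iff hB hB_bdd hA hx₀ hg (y := y)
  have hzero : ∀ c, (fun x => evolution A B x₀ x (c + ∫ s in x₀..x, evolutionInv A B x₀ s (g s)))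
      =O[𝓝[>] 0] (fun x : ℝ => x) ↔
        Q₀ c = ∫ s in Ioc 0 x₀, Q₀ (evolutionInv A B x₀ s (g s)) := fun c =>
    ⟨projection_eq_of_isBigO hB hB_bdd hA hx₀ (fun v hv => (hV v).1 hv) hg,
      isBigO_of_projection_eq hB hB_bdd hA hx₀ hV hg⟩
  have hinf : ∀ c, Tendsto
      (fun x => evolution A B x₀ x (c + ∫ s in x₀..x, evolutionInv A B x₀ s (g s)))
      atTop (𝓝 0) ↔ Q c = -∫ s in Ioi x₀, Q (evolutionInv A B x₀ s (g s)) := fun c =>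
    ⟨projection_eq_of_tendsto_atTop hB hx₀ hD (fun v hv => (hU v).1 hv) hg' hg_lim,
      tendsto_atTop_of_projection_eq hB hx₀ hD hU hg' hg_lim⟩
  have hQ₀int : (∫ s in Ioc 0 x₀, Q₀ (evolutionInv A B x₀ s (g s))) =
      (∫ s in Ioc 0 x₀, S (evolutionInv A B x₀ s (g s))) +
        ∫ s in Ioc 0 x₀, R (evolutionInv A B x₀ s (g s)) := by
    rw [← integral_add (hz1 x₀) (hz2 x₀)]
    simp only [hQ₀eq]
  have hc₀Q : Q c₀ = -∫ s in Ioi x₀, Q (evolutionInv A B x₀ s (g s)) := by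
    rw [hc₀, map_sub, ← Q.integral_comp_comm (hz1 x₀), ← Q.integral_comp_comm (hi1 x₀ hx₀)]
    simp only [hQS, hQQ, integral_zero, zero_sub]
  -- The Green constant c₀ always meets the condition at infinity; at zero it has -∫_{x₀}^∞ RY⁻¹g in
  -- place of ∫_0^{x₀} RY⁻¹g, and the defect is exactly the solvability integral.
  have hc₀Q₀ : Q₀ c₀ = (∫ s in Ioc 0 x₀, S (evolutionInv A B x₀ s (g s))) -
      ∫ s in Ioi x₀, R (evolutionInv A B x₀ s (g s)) := by
    rw [hc₀, map_sub, ← Q₀.integral_comp_comm (hz1 x₀), ← Q₀.integral_comp_comm (hi1 x₀ hx₀)]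
    simp only [hSS, hQ₀Q]
  have hnec : (∃ y, IsBVPSolution A B g y) →
      (∫ s in Ioi (0 : ℝ), R (evolutionInv A B x₀ s (g s))) = 0 := by
    rintro ⟨y, hy⟩
    obtain ⟨-, c, -, h1, h2⟩ := (hsolve y).1 hy
    -- R vanishes on both V₊ and U₋, so each end determines Rc; equating the two values gives the
    -- criterion.
    have h3 := projection_eq_of_isBigO hB hB_bdd hA hx₀ (Q := R)
      (fun v hv => by rw [← hRQ₀, (hV v).1 hv, map_zero]) hg h1
    have h4 := projection_eq_of_tendsto_atTop hB hx₀ hD (Q := R)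
      (fun v hv => by rw [← hRQ, (hU v).1 hv, map_zero]) hg' hg_lim h2
    rw [hRsplit, ← h3, h4, neg_add_cancel]
  have hchar : (∫ s in Ioi (0 : ℝ), R (evolutionInv A B x₀ s (g s))) = 0 →
      ∀ y : ℝ → E, IsBVPSolution A B g y ↔ y 0 = 0 ∧ ∃ v ∈ L 0, ∀ x, 0 < x →
        y x = evolution A B x₀ x v + ∫ s in Ioi (0 : ℝ), green A B x₀ L x s (g s) := by
    intro hJ y
    rw [hRsplit] at hJ
    have hc₀' : Q₀ c₀ = ∫ s in Ioc 0 x₀, Q₀ (evolutionInv A B x₀ s (g s)) := by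
      rw [hc₀Q₀, hQ₀int, eq_neg_of_add_eq_zero_left hJ, sub_eq_add_neg]
    rw [hsolve]
    refine and_congr_right fun _ => ⟨?_, ?_⟩
    · rintro ⟨c, hc, h1, h2⟩
      rw [hzero, ← hc₀'] at h1
      rw [hinf, ← hc₀Q] at h2
      refine ⟨c - c₀, ?_, fun x hx => ?_⟩
      · rw [hL.L1_eq]
        exact ⟨(hU _).2 (by rw [map_sub, h2, sub_self]), (hV _).2 (by rw [map_sub, h1, sub_self])⟩
      · rw [hc x hx, (hgreen x hx).2, ← map_add]
        congr 1
        abel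
    · rintro ⟨v, hv, h⟩
      rw [hL.L1_eq] at hv
      refine ⟨v + c₀, fun x hx => ?_, (hzero _).2 ?_, (hinf _).2 ?_⟩
      · rw [h x hx, (hgreen x hx).2, ← map_add, add_assoc]
      · rw [map_add, (hV v).1 hv.2, zero_add, hc₀']
      · rw [map_add, (hU v).1 hv.1, zero_add, hc₀Q]
  refine ⟨hRint, fun x hx => (hgreen x hx).1, ⟨hnec, fun hJ => ?_⟩, hchar⟩
  -- The solution with v = 0. Its value at 0 is set by hand, since the integral formula is only
  -- meant for x > 0.
  refine ⟨fun x => if x = 0 then 0 else ∫ s in Ioi (0 : ℝ), green A B x₀ L x s (g s),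
    (hchar hJ _).2 ⟨if_pos rfl, 0, zero_mem _, fun x hx => ?_⟩⟩
  simp only [if_neg hx.ne', map_zero, zero_add]
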